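/- Let $\mathfrak g$ be a simple finite-dimensional complex Lie algebra, $\mathfrak h$ a Cartan subalgebra, $\Omega\subset\mathfrak h^*$ the roots, $\Omega^+$ a system of positive roots with simple roots $\Pi$. Let $E_\alpha$ ($\alpha\in\Omega$) be root vectors with $(E_\alpha,E_{-\alpha})=1$ for the Killing form. Let $\Gamma\subset\Pi$, let $\mathfrak h^*_\Gamma$ be the span of $\Gamma$, $\Omega_\Gamma=\Omega\cap\mathfrak h^*_\Gamma$, let $\mathfrak g_\Gamma$ be the Levi subalgebra generated by $\mathfrak h$ and $E_{\pm\alpha}$, $\alpha\in\Gamma$, and let $\mathfrak m$ be its complement spanned by the $E_\gamma$, $\gamma\in\Omega\setminus\Omega_\Gamma$. Let $M=G/G_\Gamma$ be the corresponding semisimple orbit. Invariant polyvector fields on $M$ are identified with $\mathfrak g_\Gamma$-invariant elements of $\wedge^\bullet\mathfrak m\cong\wedge^\bullet(\mathfrak g/\mathfrak g_\Gamma)$; accordingly Schouten brackets on $M$ are computed in $\wedge^\bullet\mathfrak g$ and then reduced to $\wedge^\bullet(\mathfrak g/\mathfrak g_\Gamma)$. Here $[\![X_1\wedge X_2,Y_1\wedge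 Y_2]\!]=\sum_{i,j}(-1)^{i+j}[X_i,Y_j]\wedge X_{3-i}\wedge Y_{3-j}$. Let $r=\sum_{\alpha\in\Omega^+}E_\alpha\wedge E_{-\alpha}$, $\varphi=[\![r,r]\!]$, and let $\varphi_M$ be the reduction of $\varphi$. The nonzero images $\bar\alpha$ of roots in $\mathfrak h^*/\mathfrak h^*_\Gamma\cong\mathfrak h^*_{\Pi\setminus\Gamma}$ are called quasiroots, those of positive roots positive quasiroots, and the images $\bar\alpha_1,\dots,\bar\alpha_k$ of the elements of $\Pi\setminus\Gamma$ simple quasiroots ($k=|\Pi\setminus\Gamma|$). Every positive quasiroot is, uniquely up to order, a sum of simple quasiroots with possible repetitions. Let $K\in\mathbb C$. Given $(c_1,\dots,c_k)\in\mathbb C^k$ and a positive quasiroot $\bar\alpha=\bar\alpha_{i_1}+\cdots+\bar\alpha_{i_l}$ put $$c(\bar\alpha)=\frac{e_l+K^2e_{l-2}+K^4e_{l-4}+\cdots}{e_{l-1}+K^2e_{l-3}+K^4e_{l-5}+\cdots},\qquad(*)$$ where $e_j$ is the $j$-th elementary symmetric polynomial in $c_{i_1},\dots,c_{i_l}$.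 Call $(c_1,\dots,c_k)$ admissible for $K$ if all $c_i\ne0$ and none of the denominators in $(*)$ vanishes, for any positive quasiroot $\bar\alpha$. **(a)** For every $K$, the admissible points are the complement in $\mathbb C^k$ of the zero set of a nonzero polynomial. For every admissible $(c_1,\dots,c_k)$, the numbers $(*)$ satisfy $c(\bar\alpha_i)=c_i$, and the bivector $v=\sum_{\alpha\in\Omega^+\setminus\Omega_\Gamma}c(\bar\alpha)\,E_\alpha\wedge E_{-\alpha}$ lies in $\wedge^2\mathfrak m$, is $\mathfrak g_\Gamma$-invariant and satisfies $[\![v,v]\!]=K^2\varphi_M$ on $M$; moreover $(*)$ gives the only system of numbers $c(\bar\alpha)$, indexed by the positive quasiroots, with $c(\bar\alpha_i)=c_i$ for all $i$ for which $[\![v,v]\!]=K^2\varphi_M$. Thus $(c_1,\dots,c_k)\mapsto v$ is a bijection from the set of admissible points onto the set of $\mathfrak g_\Gamma$-invariant bivectors $v=\sum c(\bar\alpha)E_\alpha\wedge E_{-\alpha}$ in $\wedge^2\mathfrak m$ with $[\![v,v]\!]=K^2\varphi_M$ whose coefficients at the simple quasiroots form an admissible point: these brackets form a $k$-parameter family.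 **(b)** Let $K=0$, and let $v=\sum c(\bar\alpha)E_\alpha\wedge E_{-\alpha}$ be any solution of $[\![v,v]\!]=K^2\varphi_M=0$ on $M$ (for instance one of those in (a)). Then $v$ defines a Poisson bracket on $M$: whenever $\mathfrak g$ acts by derivations on a commutative $\mathbb C$-algebra $A$ (such as the functions on the preimage in $G$ of an open subset of $M$, with $\mathfrak g$ acting by left invariant vector fields), $\{a,b\}=\sum c(\bar\alpha)\,(E_\alpha a\,E_{-\alpha}b-E_{-\alpha}a\,E_\alpha b)$ is a Poisson bracket on the algebra of elements of $A$ annihilated by $\mathfrak g_\Gamma$. If moreover $c(\bar\alpha_i)\ne0$ for all simple quasiroots, there is a linear form $\lambda$ on $\mathfrak h^*/\mathfrak h^*_\Gamma\cong\mathfrak h^*_{\Pi\setminus\Gamma}$, nonzero on all quasiroots, such that $c(\bar\alpha)=1/\lambda(\bar\alpha)$ for all positive quasiroots $\bar\alpha$. -/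

import Mathlib

open Module LieAlgebra.IsKilling

universe u w

noncomputable section

namespace SemisimpleOrbit

/-! ### Bivectors and trivectors over a vector space, and the Schouten bracket -/

section Multilinear

variable {V N : Type*} [AddCommGroup V] [Module ℂ V] [AddCommGroup N] [Module ℂ N]

/-- The decomposable bivector `x ∧ y`. -/
def wedge₂ (x y : V) : ⋀[ℂ]^2 V := exteriorPower.ιMulti ℂ 2 ![x, y]

/-- The decomposable trivector `x ∧ y ∧ z`. -/
def wedge₃ (x y z : V) : ⋀[ℂ]^3 V := exteriorPower.ιMulti ℂ 3 ![x, y, z]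

/-- The linear map `⋀² V → N` with `x ∧ y ↦ B x y`, for an alternating bilinear map `B`
(universal property of the second exterior power). -/
def liftBilin (B : V →ₗ[ℂ] V →ₗ[ℂ] N) (hB : ∀ x, B x x = 0) : ⋀[ℂ]^2 V →ₗ[ℂ] N :=
  exteriorPower.alternatingMapLinearEquiv
    { toFun := fun m => B (m 0) (m 1)
      map_update_add' := by
        intro _ m i x y
        fin_cases i <;> simp
      map_update_smul' := by
        intro _ m i c x
        fin_cases i <;> simp
      map_eq_zero_of_eq' := by
        intro m i j h hij
        fin_cases i <;> fin_cases j <;> simp_all }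

theorem liftBilin_wedge₂ (B : V →ₗ[ℂ] V →ₗ[ℂ] N) (hB : ∀ x, B x x = 0) (x y : V) :
    liftBilin B hB (wedge₂ x y) = B x y := by
  simp [liftBilin, wedge₂]

theorem coe_wedge₂ (x y : V) : (wedge₂ x y : ExteriorAlgebra ℂ V) =
    ExteriorAlgebra.ι ℂ x * ExteriorAlgebra.ι ℂ y := by
  simp [wedge₂, ExteriorAlgebra.ιMulti_apply]

theorem coe_wedge₃ (x y z : V) : (wedge₃ x y z : ExteriorAlgebra ℂ V) =
    ExteriorAlgebra.ι ℂ x * (ExteriorAlgebra.ι ℂ y * ExteriorAlgebra.ι ℂ z) := by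
  simp [wedge₃, ExteriorAlgebra.ιMulti_apply]

end Multilinear

section Schouten

variable {g : Type*} [LieRing g] [LieAlgebra ℂ g]

/-- The value of the Schouten bracket on decomposable bivectors,
`⟦x₁ ∧ x₂, y₁ ∧ y₂⟧ = ∑ i j, (-1)^(i+j) [xᵢ, yⱼ] ∧ x_{3-i} ∧ y_{3-j}`. -/
def schoutenDecomp (x₁ x₂ y₁ y₂ : g) : ⋀[ℂ]^3 g :=
  wedge₃ ⁅x₁, y₁⁆ x₂ y₂ - wedge₃ ⁅x₁, y₂⁆ x₂ y₁ - wedge₃ ⁅x₂, y₁⁆ x₁ y₂ + wedge₃ ⁅x₂, y₂⁆ x₁ y₁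

/-- The Schouten bracket of a decomposable bivector with an arbitrary one. -/
def schoutenRight (x₁ x₂ : g) : ⋀[ℂ]^2 g →ₗ[ℂ] ⋀[ℂ]^3 g :=
  liftBilin
    (LinearMap.mk₂ ℂ (schoutenDecomp x₁ x₂)
      (by intros; apply Subtype.ext
          simp [schoutenDecomp, coe_wedge₃, mul_add, add_mul]; abel)
      (by intros; apply Subtype.ext
          simp [schoutenDecomp, coe_wedge₃, smul_sub, smul_add])
      (by intros; apply Subtype.ext
          simp [schoutenDecomp, coe_wedge₃, mul_add, add_mul]; abel)
      (by intros; apply Subtype.ext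
          simp [schoutenDecomp, coe_wedge₃, smul_sub, smul_add]))
    (by intro y; simp [schoutenDecomp])

theorem schoutenRight_wedge₂ (x₁ x₂ y₁ y₂ : g) :
    schoutenRight x₁ x₂ (wedge₂ y₁ y₂) = schoutenDecomp x₁ x₂ y₁ y₂ := by
  simp [schoutenRight, liftBilin_wedge₂]

theorem bivector_hom_ext {N : Type*} [AddCommGroup N] [Module ℂ N]
    {f h : ⋀[ℂ]^2 g →ₗ[ℂ] N} (H : ∀ x y, f (wedge₂ x y) = h (wedge₂ x y)) : f = h := by
  apply exteriorPower.linearMap_ext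
  ext m
  have : m = ![m 0, m 1] := by ext i; fin_cases i <;> rfl
  rw [this]
  exact H _ _

/-- The Schouten bracket `⟦·,·⟧ : ⋀² g × ⋀² g → ⋀³ g`. -/
def schouten : ⋀[ℂ]^2 g →ₗ[ℂ] ⋀[ℂ]^2 g →ₗ[ℂ] ⋀[ℂ]^3 g :=
  liftBilin
    (LinearMap.mk₂ ℂ schoutenRight
      (by intros; apply bivector_hom_ext; intros; apply Subtype.ext
          simp [schoutenRight_wedge₂, schoutenDecomp, coe_wedge₃, mul_add, add_mul]; abel)
      (by intros; apply bivector_hom_ext; intros; apply Subtype.ext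
          simp [schoutenRight_wedge₂, schoutenDecomp, coe_wedge₃, smul_sub, smul_add])
      (by intros; apply bivector_hom_ext; intros; apply Subtype.ext
          simp [schoutenRight_wedge₂, schoutenDecomp, coe_wedge₃, mul_add, add_mul]; abel)
      (by intros; apply bivector_hom_ext; intros; apply Subtype.ext
          simp [schoutenRight_wedge₂, schoutenDecomp, coe_wedge₃, smul_sub, smul_add]))
    (by intro x; apply bivector_hom_ext; intros
        simp [schoutenRight_wedge₂, schoutenDecomp])

theorem schouten_wedge₂ (x₁ x₂ y₁ y₂ : g) :
    schouten (wedge₂ x₁ x₂) (wedge₂ y₁ y₂) = schoutenDecomp x₁ x₂ y₁ y₂ := by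
  simp [schouten, liftBilin_wedge₂, schoutenRight_wedge₂]

/-- The adjoint action of `x` on bivectors, `y ∧ z ↦ [x, y] ∧ z + y ∧ [x, z]`. -/
def adBivector (x : g) : ⋀[ℂ]^2 g →ₗ[ℂ] ⋀[ℂ]^2 g :=
  liftBilin
    (LinearMap.mk₂ ℂ (fun y z => wedge₂ ⁅x, y⁆ z + wedge₂ y ⁅x, z⁆)
      (by intros; apply Subtype.ext; simp [coe_wedge₂, add_mul]; abel)
      (by intros; apply Subtype.ext; simp [coe_wedge₂, smul_add])
      (by intros; apply Subtype.ext; simp [coe_wedge₂, mul_add]; abel)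
      (by intros; apply Subtype.ext; simp [coe_wedge₂, smul_add]))
    (by
      intro y
      apply Subtype.ext
      simp only [LinearMap.mk₂_apply, Submodule.coe_add, coe_wedge₂, Submodule.coe_zero]
      exact ExteriorAlgebra.ι_add_mul_swap _ _)

/-- The biderivation `{a, b} = v(da, db)` which a bivector `v` over `g` defines on a commutative
algebra `A` on which `g` acts by derivations: for `v = x ∧ y` it is
`{a, b} = x(a) y(b) - y(a) x(b)`. -/
def bivectorBracket {A : Type*} [CommRing A] [Algebra ℂ A]
    (ρ : g →ₗ⁅ℂ⁆ Derivation ℂ A A) (v : ⋀[ℂ]^2 g) (a b : A) : A :=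
  liftBilin
    (LinearMap.mk₂ ℂ (fun x y => ρ x a * ρ y b - ρ y a * ρ x b)
      (by intros; simp; ring)
      (by intros; simp [smul_sub])
      (by intros; simp; ring)
      (by intros; simp [smul_sub]))
    (by intro x; simp) v

/-- `br` is a Poisson bracket on the commutative algebra formed by the elements of `S ⊆ A`. -/
structure IsPoissonBracketOn {A : Type*} [CommRing A] [Algebra ℂ A] (S : Set A)
    (br : A → A → A) : Prop where
  mem : ∀ a ∈ S, ∀ b ∈ S, br a b ∈ S
  add : ∀ a ∈ S, ∀ b ∈ S, ∀ c ∈ S, br a (b + c) = br a b + br a c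
  smul : ∀ (t : ℂ), ∀ a ∈ S, ∀ b ∈ S, br a (t • b) = t • br a b
  skew : ∀ a ∈ S, ∀ b ∈ S, br a b = -br b a
  leibniz : ∀ a ∈ S, ∀ b ∈ S, ∀ c ∈ S, br a (b * c) = br a b * c + b * br a c
  jacobi : ∀ a ∈ S, ∀ b ∈ S, ∀ c ∈ S, br a (br b c) + br b (br c a) + br c (br a b) = 0

end Schouten

/-! ### Formula for the coefficients -/

/-- The numerator `e_l + K² e_{l-2} + K⁴ e_{l-4} + ⋯` in the numbers `c₁, …, c_l`, where `e_j` is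
the `j`-th elementary symmetric polynomial. -/
def numer (K : ℂ) (s : Multiset ℂ) : ℂ :=
  ∑ j ∈ Finset.range (s.card / 2 + 1), K ^ (2 * j) * s.esymm (s.card - 2 * j)

/-- The denominator `e_{l-1} + K² e_{l-3} + K⁴ e_{l-5} + ⋯` in the numbers `c₁, …, c_l`. -/
def denom (K : ℂ) (s : Multiset ℂ) : ℂ :=
  ∑ j ∈ Finset.range ((s.card + 1) / 2), K ^ (2 * j) * s.esymm (s.card - (2 * j + 1))

/-! ### Levi subalgebras, quasiroots, and invariant brackets -/

section Lie

variable {g : Type*} [LieRing g] [LieAlgebra ℂ g] [FiniteDimensional ℂ g]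
  [LieAlgebra.IsKilling ℂ g]
  {H : LieSubalgebra ℂ g} [H.IsCartanSubalgebra]

/-- A choice of root vectors `E_α` with `(E_α, E_{-α}) = 1` for the Killing form. (Only the values
of `E` at the nonzero weights, i.e. at the roots, matter.) -/
structure IsRootVectors (E : LieModule.Weight ℂ H g → g) : Prop where
  mem : ∀ α : LieModule.Weight ℂ H g, α.IsNonZero → E α ∈ LieAlgebra.rootSpace H α
  killing : ∀ α : LieModule.Weight ℂ H g, α.IsNonZero → killingForm ℂ g (E α) (E (-α)) = 1

/-- `h*_Γ`, the subspace of `h*` spanned by `Γ`. -/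
def hGamma (Γ : Set H.root) : Submodule ℂ (Dual ℂ H) :=
  Submodule.span ℂ ((rootSystem H).root '' Γ)

/-- The image of the root `α` in `h*/h*_Γ`. -/
def bar (Γ : Set H.root) (α : H.root) : Dual ℂ H ⧸ hGamma Γ :=
  (hGamma Γ).mkQ ((rootSystem H).root α)

/-- `α` does not lie in the subsystem `Ω_Γ = Ω ∩ h*_Γ`. -/
def IsOutside (Γ : Set H.root) (α : H.root) : Prop := (rootSystem H).root α ∉ hGamma Γ

/-- Quasiroots: the nonzero images of the roots in `h*/h*_Γ`. -/
def quasiroots (Γ : Set H.root) : Set (Dual ℂ H ⧸ hGamma Γ) :=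
  {q | q ≠ 0 ∧ ∃ α : H.root, bar Γ α = q}

/-- Positive quasiroots: the nonzero images of the positive roots. -/
abbrev PosQuasiroot (b : (rootSystem H).Base) (Γ : Set H.root) : Type _ :=
  {q : Dual ℂ H ⧸ hGamma Γ // q ≠ 0 ∧ ∃ α : H.root, b.IsPos α ∧ bar Γ α = q}

/-- `Ω⁺ ∖ Ω_Γ`. -/
abbrev PosOutside (b : (rootSystem H).Base) (Γ : Set H.root) : Type _ :=
  {α : H.root // b.IsPos α ∧ IsOutside Γ α}

/-- `Π ∖ Γ`, which indexes the simple quasiroots. -/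
abbrev SimpleOutside (b : (rootSystem H).Base) (Γ : Set H.root) : Type _ :=
  {α : H.root // α ∈ b.support ∧ α ∉ Γ}

variable {b : (rootSystem H).Base} {Γ : Set H.root}

/-- The positive quasiroot `ᾱ` of a root `α ∈ Ω⁺ ∖ Ω_Γ`. -/
def PosOutside.bar (α : PosOutside b Γ) : PosQuasiroot b Γ :=
  ⟨SemisimpleOrbit.bar Γ α.1,
    fun h => α.2.2 (by simpa [SemisimpleOrbit.bar] using h), α.1, α.2.1, rfl⟩

theorem coord_eq_zero (hΓ : Γ ⊆ b.support) (i : b.support) (hi : i.1 ∉ Γ) :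
    hGamma Γ ≤ LinearMap.ker (b.toWeightBasis.coord i) := by
  classical
  rw [hGamma, Submodule.span_le]
  rintro _ ⟨j, hj, rfl⟩
  have := b.toWeightBasis_repr_root ⟨j, hΓ hj⟩
  simp only [SetLike.mem_coe, LinearMap.mem_ker, Basis.coord_apply]
  rw [this, Finsupp.single_apply, if_neg]
  rintro rfl
  exact hi hj

theorem simple_isOutside (hΓ : Γ ⊆ b.support) (i : SimpleOutside b Γ) : IsOutside Γ i.1 := by
  intro h
  have h1 := coord_eq_zero hΓ ⟨i.1, i.2.1⟩ i.2.2 h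
  have h2 := b.toWeightBasis_repr_root ⟨i.1, i.2.1⟩
  simp only [LinearMap.mem_ker, Basis.coord_apply] at h1
  rw [h2] at h1
  simp at h1

/-- A simple root outside `Γ`, as an element of `Ω⁺ ∖ Ω_Γ`. -/
def SimpleOutside.toPosOutside (hΓ : Γ ⊆ b.support) (i : SimpleOutside b Γ) : PosOutside b Γ :=
  ⟨i.1, b.isPos_of_mem_support i.2.1, simple_isOutside hΓ i⟩

/-- The simple quasiroot `ᾱᵢ`. -/
def simpleQuasiroot (hΓ : Γ ⊆ b.support) (i : SimpleOutside b Γ) : PosQuasiroot b Γ :=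
  (i.toPosOutside hΓ).bar

/-- Every positive quasiroot is, in exactly one way, a sum `ᾱ₁ + ⋯ + ᾱ_l` of simple quasiroots
with possible repetitions. -/
theorem existsUnique_decomposition (hΓ : Γ ⊆ b.support) (q : PosQuasiroot b Γ) :
    ∃! s : Multiset (SimpleOutside b Γ),
      (s.map fun i => (simpleQuasiroot hΓ i).1).sum = q.1 := by
  classical
  have huniq : ∀ (i : SimpleOutside b Γ) (s : Multiset (SimpleOutside b Γ)),
      (hGamma Γ).liftQ _ (coord_eq_zero hΓ ⟨i.1, i.2.1⟩ i.2.2)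
        (s.map fun i => (simpleQuasiroot hΓ i).1).sum = (s.count i : ℂ) := by
    intro i s
    induction s using Multiset.induction_on with
    | empty => simp
    | cons j s ih =>
      rw [Multiset.map_cons, Multiset.sum_cons, map_add, ih, Multiset.count_cons]
      have h2 := b.toWeightBasis_repr_root ⟨j.1, j.2.1⟩
      have h3 : (hGamma Γ).liftQ _ (coord_eq_zero hΓ ⟨i.1, i.2.1⟩ i.2.2)
          (simpleQuasiroot hΓ j).1 = if i = j then 1 else 0 := by
        change b.toWeightBasis.repr ((rootSystem H).root j.1) ⟨i.1, i.2.1⟩ = _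
        rw [h2, Finsupp.single_apply]
        by_cases hij : i = j
        · subst hij; simp
        · have : ¬ j.1 = i.1 := fun h => hij (Subtype.ext h.symm)
          simp [hij, this]
      rw [h3]
      push_cast
      ring
  obtain ⟨q, hq, α, hα, rfl⟩ := q
  have hex : ∃ s : Multiset (SimpleOutside b Γ),
      (s.map fun i => (simpleQuasiroot hΓ i).1).sum = bar Γ α := by
    clear hq
    refine RootPairing.Base.IsPos.induction_on_add (b := b) hα (p := fun α =>
      ∃ s : Multiset (SimpleOutside b Γ),
        (s.map fun i => (simpleQuasiroot hΓ i).1).sum = bar Γ α) ?_ ?_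
    · intro i hi
      by_cases hiΓ : i ∈ Γ
      · refine ⟨0, ?_⟩
        have : (rootSystem H).root i ∈ hGamma Γ := Submodule.subset_span ⟨i, hiΓ, rfl⟩
        have h0 : bar Γ i = 0 := by simpa [bar] using this
        simp [h0]
      · exact ⟨{⟨i, hi, hiΓ⟩}, by simp [simpleQuasiroot, PosOutside.bar,
          SimpleOutside.toPosOutside]⟩
    · intro i j k hijk ih hj
      obtain ⟨s, hs⟩ := ih
      have hk : bar Γ k = bar Γ i + bar Γ j := by simp only [bar, hijk, map_add]
      by_cases hjΓ : j ∈ Γ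
      · refine ⟨s, ?_⟩
        have : (rootSystem H).root j ∈ hGamma Γ := Submodule.subset_span ⟨j, hjΓ, rfl⟩
        have h0 : bar Γ j = 0 := by simpa [bar] using this
        rw [hs, hk, h0, add_zero]
      · refine ⟨⟨j, hj, hjΓ⟩ ::ₘ s, ?_⟩
        rw [Multiset.map_cons, Multiset.sum_cons, hs, hk, add_comm]
        rfl
  obtain ⟨s, hs⟩ := hex
  refine ⟨s, hs, fun t ht => ?_⟩
  ext i
  have h1 := huniq i s
  have h2 := huniq i t
  rw [hs] at h1
  rw [ht] at h2
  exact_mod_cast h2.symm.trans h1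

/-- The multiset of simple quasiroots `ᾱ₁, …, ᾱ_l` whose sum is the given positive quasiroot. -/
def decomposition (hΓ : Γ ⊆ b.support) (q : PosQuasiroot b Γ) : Multiset (SimpleOutside b Γ) :=
  (existsUnique_decomposition hΓ q).choose

/-- The values `c₁, …, c_l` (with repetitions) at the simple quasiroots occurring in `q`. -/
def simpleValues (hΓ : Γ ⊆ b.support) (c : SimpleOutside b Γ → ℂ) (q : PosQuasiroot b Γ) :
    Multiset ℂ :=
  (decomposition hΓ q).map c

/-- The number `c(ᾱ)` computed from the values `cᵢ` at the simple quasiroots: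
`c(ᾱ) = (e_l + K² e_{l-2} + ⋯) / (e_{l-1} + K² e_{l-3} + ⋯)` for `ᾱ = ᾱ₁ + ⋯ + ᾱ_l`. -/
def coeffFormula (hΓ : Γ ⊆ b.support) (K : ℂ) (c : SimpleOutside b Γ → ℂ) :
    PosQuasiroot b Γ → ℂ :=
  fun q => numer K (simpleValues hΓ c q) / denom K (simpleValues hΓ c q)

/-- The admissible points `(c₁, …, c_k) ∈ ℂ^k`: all `cᵢ` are nonzero and no denominator
vanishes. -/
def admissible (hΓ : Γ ⊆ b.support) (K : ℂ) : Set (SimpleOutside b Γ → ℂ) :=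
  {c | (∀ i, c i ≠ 0) ∧ ∀ q : PosQuasiroot b Γ, denom K (simpleValues hΓ c q) ≠ 0}

variable (E : LieModule.Weight ℂ H g → g)

/-- The Levi subalgebra `g_Γ`, generated by `h` and `E_α`, `E_{-α}`, `α ∈ Γ`. -/
def levi (Γ : Set H.root) : LieSubalgebra ℂ g :=
  LieSubalgebra.lieSpan ℂ g ((H : Set g) ∪ {x | ∃ α ∈ Γ, x = E α.1 ∨ x = E (-α.1)})

/-- The complement `m` of `g_Γ` in `g`, spanned by the `E_γ` with `γ ∈ Ω ∖ Ω_Γ`. -/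
def mGamma (Γ : Set H.root) : Submodule ℂ g :=
  Submodule.span ℂ {x | ∃ α : H.root, IsOutside Γ α ∧ x = E α.1}

/-- The subspace `⋀² m` of `⋀² g`. -/
def bivectorsInM (Γ : Set H.root) : Submodule ℂ (⋀[ℂ]^2 g) :=
  LinearMap.range (exteriorPower.map 2 (mGamma E Γ).subtype)

/-- Invariance of a bivector under the adjoint action of `g_Γ`. The `g_Γ`-invariant elements of
`⋀² m` are identified with the invariant bivector fields on `M = G/G_Γ`. -/
def IsLeviInvariant (Γ : Set H.root) (v : ⋀[ℂ]^2 g) : Prop :=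
  ∀ x ∈ levi E Γ, adBivector x v = 0

/-- The value at the base point of `M = G/G_Γ` of the trivector field on `M` defined by a trivector
over `g`, i.e. the image in `⋀³ T_oM`, where `T_oM = g/g_Γ ≅ m`. -/
def toM (Γ : Set H.root) : ⋀[ℂ]^3 g →ₗ[ℂ] ⋀[ℂ]^3 (g ⧸ (levi E Γ).toSubmodule) :=
  exteriorPower.map 3 (levi E Γ).toSubmodule.mkQ

/-- The Drinfeld-Jimbo `r`-matrix `r = ∑_{α ∈ Ω⁺} E_α ∧ E_{-α}`. -/
def rMatrix (b : (rootSystem H).Base) : ⋀[ℂ]^2 g :=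
  letI := Fintype.ofFinite {α : H.root // b.IsPos α}
  ∑ α : {α : H.root // b.IsPos α}, wedge₂ (E α.1.1) (E (-α.1.1))

/-- The invariant trivector `φ = ⟦r, r⟧` reduced to `M`. -/
def phiM (b : (rootSystem H).Base) (Γ : Set H.root) : ⋀[ℂ]^3 (g ⧸ (levi E Γ).toSubmodule) :=
  toM E Γ (schouten (rMatrix E b) (rMatrix E b))

/-- The bivector `∑ c(ᾱ) E_α ∧ E_{-α}`, summed over `α ∈ Ω⁺ ∖ Ω_Γ`. -/
def bivector (c : PosQuasiroot b Γ → ℂ) : ⋀[ℂ]^2 g :=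
  letI := Fintype.ofFinite (PosOutside b Γ)
  ∑ α : PosOutside b Γ, c α.bar • wedge₂ (E α.1.1) (E (-α.1.1))

/-- The condition `⟦v, v⟧ = K² φ_M` on `M`. -/
def SatisfiesSchouten (b : (rootSystem H).Base) (Γ : Set H.root) (K : ℂ) (v : ⋀[ℂ]^2 g) : Prop :=
  toM E Γ (schouten v v) = K ^ 2 • phiM E b Γ

/-- The invariant bivector fields `v = ∑ c(ᾱ) E_α ∧ E_{-α}` on `M` with `⟦v, v⟧ = K² φ_M` whose
coefficients at the simple quasiroots form an admissible point. -/
def bracketFamily (hΓ : Γ ⊆ b.support) (K : ℂ) : Set (⋀[ℂ]^2 g) :=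
  {v | v ∈ bivectorsInM E Γ ∧ IsLeviInvariant E Γ v ∧ SatisfiesSchouten E b Γ K v ∧
    ∃ d : PosQuasiroot b Γ → ℂ, v = bivector E d ∧
      (fun i => d (simpleQuasiroot hΓ i)) ∈ admissible hΓ K}

/-- The bivector `v` defines a Poisson bracket on `M = G/G_Γ`.
The functions on an open set `U ⊆ M` are the functions on its preimage in `G` (a commutative
algebra `A` on which `g` acts by left invariant vector fields) which are annihilated by `g_Γ`, and
the bracket of two of them is obtained by applying the left invariant bivector field `v`. The
condition is imposed for every commutative algebra `A` with an action of `g` by derivations. -/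
def DefinesPoissonBracket (Γ : Set H.root) (v : ⋀[ℂ]^2 g) : Prop :=
  ∀ (A : Type w) [CommRing A] [Algebra ℂ A] (ρ : g →ₗ⁅ℂ⁆ Derivation ℂ A A),
    IsPoissonBracketOn {a : A | ∀ x ∈ levi E Γ, ρ x a = 0} (bivectorBracket ρ v)

end Lie

end SemisimpleOrbit

end

open SemisimpleOrbit

/-!
The Killing form turns a bivector into an endomorphism of `g`, for which the root vectors are
eigenvectors when the bivector is `∑ c(ᾱ) E_α ∧ E_{-α}`. Evaluated at three root vectors with
`α + β + γ = 0`, the equation `⟦v, v⟧ = K² φ_M` is therefore a quadratic equation for the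
coefficients: `c(α + β) (c(α) + c(β)) = c(α) c(β) + K²` for positive roots outside `Ω_Γ`.
With `ω² = K²` it says that `c(α + β) + ω` is proportional to `(c(α) + ω) (c(β) + ω)`. Hence a
solution is determined by its values at the simple quasiroots, `c(ᾱ)` being the ratio of the two
coordinates of `∏ (cᵢ + ω)` with respect to `1, ω`; this is the formula with the elementary
symmetric polynomials. At `K = 0` the equation says that `1 / c` is additive.
-/

noncomputable section

namespace SemisimpleOrbit

/-! ### The product `∏ (cᵢ + ω)` with `ω² = K²` -/

section NumerDenom

theorem sum_range_succ_eq_sum_even_add_sum_odd {M : Type*} [AddCommMonoid M] (f : ℕ → M) (n : ℕ) :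
    ∑ i ∈ Finset.range (n + 1), f i =
      ∑ j ∈ Finset.range (n / 2 + 1), f (2 * j) +
        ∑ j ∈ Finset.range ((n + 1) / 2), f (2 * j + 1) := by
  induction n with
  | zero => simp
  | succ n ih =>
    rw [Finset.sum_range_succ, ih]
    obtain ⟨m, rfl | rfl⟩ := Nat.even_or_odd' n
    · rw [show 2 * m / 2 = m by omega, show (2 * m + 1) / 2 = m by omega,
        show (2 * m + 1 + 1) / 2 = m + 1 by omega, Finset.sum_range_succ (fun j => f (2 * j + 1)),
        add_assoc]
    · rw [show (2 * m + 1) / 2 = m by omega, show (2 * m + 1 + 1) / 2 = m + 1 by omega,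
        show (2 * m + 1 + 1 + 1) / 2 = m + 1 by omega,
        Finset.sum_range_succ (fun j => f (2 * j)) (m + 1), add_right_comm]
      rfl

theorem prod_map_add_eq_sum_esymm_mul_pow {R S : Type*} [CommSemiring R] [CommSemiring S]
    [Algebra R S] (s : Multiset R) (x : S) :
    (s.map fun c => x + algebraMap R S c).prod =
      ∑ i ∈ Finset.range (s.card + 1), algebraMap R S (s.esymm (s.card - i)) * x ^ i := by
  have h := congrArg (Polynomial.aeval x) s.prod_X_add_C_eq_sum_esymm
  simp only [map_multiset_prod, Multiset.map_map, Function.comp_def, map_add, Polynomial.aeval_X,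
    Polynomial.aeval_C, map_sum, map_mul, map_pow] at h
  rw [h, ← Finset.sum_range_reflect]
  refine Finset.sum_congr rfl fun i hi => ?_
  have hi : i ≤ s.card := Nat.lt_succ_iff.1 (Finset.mem_range.1 hi)
  rw [Nat.add_sub_cancel, Nat.sub_sub_self hi]

theorem prod_map_mk_one (K : ℂ) (s : Multiset ℂ) :
    (s.map fun c => (⟨c, 1⟩ : QuadraticAlgebra ℂ (K ^ 2) 0)).prod = ⟨numer K s, denom K s⟩ := by
  let ω : QuadraticAlgebra ℂ (K ^ 2) 0 := ⟨0, 1⟩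
  have even_pow (j : ℕ) : ω ^ (2 * j) = ⟨K ^ (2 * j), 0⟩ := by
    rw [pow_mul, show ω ^ 2 = .C (K ^ 2) by ext <;> simp [ω, sq], ← QuadraticAlgebra.C_pow,
      ← pow_mul]
    rfl
  have odd_pow (j : ℕ) : ω ^ (2 * j + 1) = ⟨0, K ^ (2 * j)⟩ := by
    rw [pow_succ ω, even_pow]
    ext <;> simp [ω]
  have add_root (c : ℂ) : (⟨c, 1⟩ : QuadraticAlgebra ℂ (K ^ 2) 0) = ω + algebraMap ℂ _ c := by
    ext <;> simp [ω]
  simp only [add_root, prod_map_add_eq_sum_esymm_mul_pow,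
    sum_range_succ_eq_sum_even_add_sum_odd _ s.card, even_pow, odd_pow, numer, denom]
  have re_sum (t : Finset ℕ) (f : ℕ → QuadraticAlgebra ℂ (K ^ 2) 0) :
      (∑ j ∈ t, f j).re = ∑ j ∈ t, (f j).re := map_sum (QuadraticAlgebra.reₗ _ _) _ _
  have im_sum (t : Finset ℕ) (f : ℕ → QuadraticAlgebra ℂ (K ^ 2) 0) :
      (∑ j ∈ t, f j).im = ∑ j ∈ t, (f j).im := map_sum (QuadraticAlgebra.imₗ _ _) _ _
  ext <;> simp [re_sum, im_sum, mul_comm]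

theorem mk_numer_denom_add (K : ℂ) (s t : Multiset ℂ) :
    (⟨numer K (s + t), denom K (s + t)⟩ : QuadraticAlgebra ℂ (K ^ 2) 0) =
      ⟨numer K s, denom K s⟩ * ⟨numer K t, denom K t⟩ := by
  simp only [← prod_map_mk_one, Multiset.map_add, Multiset.prod_add]

theorem numer_add (K : ℂ) (s t : Multiset ℂ) :
    numer K (s + t) = numer K s * numer K t + K ^ 2 * (denom K s * denom K t) := by
  simpa [mul_assoc] using congrArg QuadraticAlgebra.re (mk_numer_denom_add K s t)

theorem denom_add (K : ℂ) (s t : Multiset ℂ) :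
    denom K (s + t) = denom K s * numer K t + numer K s * denom K t := by
  simpa [add_comm] using congrArg QuadraticAlgebra.im (mk_numer_denom_add K s t)

theorem numer_zero (K : ℂ) : numer K 0 = 1 := by simp [numer, Multiset.esymm]

theorem denom_zero (K : ℂ) : denom K 0 = 0 := by simp [denom]

theorem numer_singleton (K a : ℂ) : numer K {a} = a := by
  simp [numer, Multiset.esymm, Multiset.powersetCard_one]

theorem denom_singleton (K a : ℂ) : denom K {a} = 1 := by simp [denom, Multiset.esymm]

theorem numer_cons (K a : ℂ) (s : Multiset ℂ) :
    numer K (a ::ₘ s) = a * numer K s + K ^ 2 * denom K s := by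
  rw [← Multiset.singleton_add, numer_add, numer_singleton, denom_singleton, one_mul]

theorem denom_cons (K a : ℂ) (s : Multiset ℂ) :
    denom K (a ::ₘ s) = a * denom K s + numer K s := by
  rw [← Multiset.singleton_add, denom_add, numer_singleton, denom_singleton, one_mul, add_comm]

theorem mul_div_add_div_eq_iff {K : ℂ} {s t : Multiset ℂ} (hs : denom K s ≠ 0)
    (ht : denom K t ≠ 0) (hst : denom K (s + t) ≠ 0) (z : ℂ) :
    z * (numer K s / denom K s + numer K t / denom K t) =
        numer K s / denom K s * (numer K t / denom K t) + K ^ 2 ↔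
      z = numer K (s + t) / denom K (s + t) := by
  have hadd : numer K s / denom K s + numer K t / denom K t =
      denom K (s + t) / (denom K s * denom K t) := by
    rw [denom_add]
    field_simp
    ring
  have hmul : numer K s / denom K s * (numer K t / denom K t) + K ^ 2 =
      numer K (s + t) / (denom K s * denom K t) := by
    rw [numer_add]
    field_simp
  rw [hadd, hmul, eq_div_iff hst, mul_div_assoc', div_left_inj' (mul_ne_zero hs ht)]

theorem exists_eval_eq_numer_and_eval_eq_denom {ι : Type*} (K : ℂ) (s : Multiset ι) :
    ∃ p q : MvPolynomial ι ℂ, ∀ c : ι → ℂ,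
      MvPolynomial.eval c p = numer K (s.map c) ∧ MvPolynomial.eval c q = denom K (s.map c) := by
  induction s using Multiset.induction_on with
  | empty => exact ⟨1, 0, by simp [numer_zero, denom_zero]⟩
  | cons i s ih =>
    obtain ⟨p, q, h⟩ := ih
    refine ⟨MvPolynomial.X i * p + MvPolynomial.C (K ^ 2) * q, MvPolynomial.X i * q + p, ?_⟩
    intro c
    simp [numer_cons, denom_cons, (h c).1, (h c).2]

theorem mk_numer_denom_replicate (K c : ℂ) (n : ℕ) :
    (⟨numer K (.replicate n c), denom K (.replicate n c)⟩ : QuadraticAlgebra ℂ (K ^ 2) 0) =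
      ⟨c, 1⟩ ^ n := by
  rw [← prod_map_mk_one, Multiset.map_replicate, Multiset.prod_replicate]

theorem denom_zero_replicate_one (n : ℕ) : denom 0 (.replicate n 1) = n := by
  have hpow : (⟨1, 1⟩ : QuadraticAlgebra ℂ (0 ^ 2) 0) ^ n = ⟨1, n⟩ := by
    induction n with
    | zero => ext <;> simp [QuadraticAlgebra.re_one, QuadraticAlgebra.im_one]
    | succ n ih => rw [pow_succ _ n, ih]; ext <;> simp [add_comm]
  rw [← mk_numer_denom_replicate] at hpow
  exact congrArg QuadraticAlgebra.im hpow

theorem denom_replicate_succ_self (K : ℂ) (n : ℕ) :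
    denom K (.replicate (n + 1) K) = (2 * K) ^ n := by
  have hpow : (⟨K, 1⟩ : QuadraticAlgebra ℂ (K ^ 2) 0) ^ (n + 1) = (2 * K) ^ n • ⟨K, 1⟩ := by
    induction n with
    | zero => simp
    | succ n ih => rw [pow_succ _ (n + 1), ih]; ext <;> simp <;> ring
  rw [← mk_numer_denom_replicate] at hpow
  simpa using congrArg QuadraticAlgebra.im hpow

theorem exists_denom_replicate_ne_zero (K : ℂ) :
    ∃ c : ℂ, c ≠ 0 ∧ ∀ n : ℕ, n ≠ 0 → denom K (.replicate n c) ≠ 0 := by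
  rcases eq_or_ne K 0 with rfl | hK
  · exact ⟨1, one_ne_zero, fun n hn => by simpa [denom_zero_replicate_one] using hn⟩
  · refine ⟨K, hK, fun n hn => ?_⟩
    obtain ⟨m, rfl⟩ := Nat.exists_eq_succ_of_ne_zero hn
    rw [Nat.succ_eq_add_one, denom_replicate_succ_self]
    exact pow_ne_zero _ (mul_ne_zero two_ne_zero hK)

end NumerDenom

/-! ### Evaluation of multivectors on linear maps -/

section EvalMultivector

variable {R A V W : Type*} [CommRing R] [CommRing A] [Algebra R A] [AddCommGroup V] [Module R V]
  [AddCommGroup W] [Module R W] {n : ℕ}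

/-- The value of a multivector on `n` linear maps into a commutative algebra: it sends
`x₁ ∧ ⋯ ∧ xₙ` to `det (fⱼ xᵢ)`. For `A = R` this is the pairing of `⋀ⁿ V` with `f₁ ∧ ⋯ ∧ fₙ`; with
`fⱼ x` the derivative of a function `aⱼ` along `x`, it is the multiderivation defined by a
multivector. -/
def evalMultivector (f : Fin n → V →ₗ[R] A) : ⋀[R]^n V →ₗ[R] A :=
  exteriorPower.alternatingMapLinearEquiv
    { (Matrix.detRowAlternating.toMultilinearMap.restrictScalars R).compLinearMap
        fun _ => LinearMap.pi f with
      map_eq_zero_of_eq' := fun _ _ _ h hij =>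
        Matrix.detRowAlternating.map_eq_zero_of_eq _ (congrArg (LinearMap.pi f) h) hij }

theorem evalMultivector_ιMulti (f : Fin n → V →ₗ[R] A) (x : Fin n → V) :
    evalMultivector f (exteriorPower.ιMulti R n x) = (Matrix.of fun i j => f j (x i)).det :=
  exteriorPower.alternatingMapLinearEquiv_apply_ιMulti _ _

theorem evalMultivector_map (f : Fin n → W →ₗ[R] A) (φ : V →ₗ[R] W) (v : ⋀[R]^n V) :
    evalMultivector f (exteriorPower.map n φ v) = evalMultivector (fun i => f i ∘ₗ φ) v := by
  suffices evalMultivector f ∘ₗ exteriorPower.map n φ = evalMultivector fun i => f i ∘ₗ φ from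
    LinearMap.congr_fun this v
  refine exteriorPower.linearMap_ext (AlternatingMap.ext fun x => ?_)
  simp [evalMultivector_ιMulti, exteriorPower.map_apply_ιMulti]

theorem eq_zero_of_evalMultivector_coord {ι : Type*} (B : Basis ι R V) {v : ⋀[R]^n V}
    (h : ∀ a : Fin n → ι, evalMultivector (fun i => B.coord (a i)) v = 0) : v = 0 := by
  classical
  let _ : LinearOrder ι := linearOrderOfSTO WellOrderingRel
  refine (B.exteriorPower n).ext_elem fun s => ?_
  have hdual : exteriorPower.ιMultiDual R n B s =
      evalMultivector fun i => B.coord (Set.powersetCard.ofFinEmbEquiv.symm s i) :=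
    exteriorPower.linearMap_ext (AlternatingMap.ext fun x => by
      simp [evalMultivector_ιMulti, exteriorPower.ιMultiDual_apply_ιMulti])
  rw [exteriorPower.basis_repr_apply, hdual, h, map_zero, Finsupp.zero_apply]

end EvalMultivector

section EvalWedge

variable {A V : Type*} [CommRing A] [Algebra ℂ A] [AddCommGroup V] [Module ℂ V]

theorem evalMultivector_wedge₂ (f₁ f₂ : V →ₗ[ℂ] A) (x₁ x₂ : V) :
    evalMultivector ![f₁, f₂] (wedge₂ x₁ x₂) = f₁ x₁ * f₂ x₂ - f₂ x₁ * f₁ x₂ := by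
  simp [wedge₂, evalMultivector_ιMulti, Matrix.det_fin_two]

theorem evalMultivector_wedge₃ (f₁ f₂ f₃ : V →ₗ[ℂ] A) (x₁ x₂ x₃ : V) :
    evalMultivector ![f₁, f₂, f₃] (wedge₃ x₁ x₂ x₃) =
      f₁ x₁ * f₂ x₂ * f₃ x₃ - f₁ x₁ * f₃ x₂ * f₂ x₃ - f₂ x₁ * f₁ x₂ * f₃ x₃ +
        f₂ x₁ * f₃ x₂ * f₁ x₃ + f₃ x₁ * f₁ x₂ * f₂ x₃ - f₃ x₁ * f₂ x₂ * f₁ x₃ := by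
  simp [wedge₃, evalMultivector_ιMulti, Matrix.det_fin_three]

end EvalWedge

/-! ### Contraction of bivectors with a bilinear form -/

section Contraction

variable {V : Type*} [AddCommGroup V] [Module ℂ V] (B : LinearMap.BilinForm ℂ V)

/-- Contraction with a bilinear form turns a bivector into an endomorphism: `x₁ ∧ x₂` becomes
`y ↦ (y, x₂) x₁ - (y, x₁) x₂`. -/
def contract : ⋀[ℂ]^2 V →ₗ[ℂ] Module.End ℂ V :=
  liftBilin
    (LinearMap.mk₂ ℂ (fun x₁ x₂ => (B.flip x₂).smulRight x₁ - (B.flip x₁).smulRight x₂)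
      (by intros; ext; simp [add_smul]; abel)
      (by intros; ext; simp; module)
      (by intros; ext; simp [add_smul]; abel)
      (by intros; ext; simp; module))
    (by intro x; simp)

theorem contract_wedge₂ (x₁ x₂ y : V) :
    contract B (wedge₂ x₁ x₂) y = B y x₂ • x₁ - B y x₁ • x₂ := by
  simp [contract, liftBilin_wedge₂]

theorem evalMultivector_eq_contract (v : ⋀[ℂ]^2 V) (y₁ y₂ : V) :
    evalMultivector ![B y₁, B y₂] v = B y₁ (contract B v y₂) := by
  suffices evalMultivector ![B y₁, B y₂] = B y₁ ∘ₗ LinearMap.applyₗ y₂ ∘ₗ contract B from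
    LinearMap.congr_fun this v
  refine exteriorPower.linearMap_ext (AlternatingMap.ext fun x => ?_)
  have hx : exteriorPower.ιMulti ℂ 2 x = wedge₂ (x 0) (x 1) := by
    rw [wedge₂, ← List.ofFn_inj.1 (by simp : List.ofFn x = List.ofFn ![x 0, x 1])]
  simp only [LinearMap.compAlternatingMap_apply, hx, evalMultivector_wedge₂, LinearMap.coe_comp,
    Function.comp_apply, LinearMap.applyₗ_apply_apply, contract_wedge₂, map_sub, map_smul,
    smul_eq_mul]
  ring

theorem contract_injective [FiniteDimensional ℂ V] {B : LinearMap.BilinForm ℂ V}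
    (hB : B.Nondegenerate) : Function.Injective (contract B) := by
  rw [injective_iff_map_eq_zero]
  intro v hv
  refine eq_zero_of_evalMultivector_coord (finBasis ℂ V) fun a => ?_
  obtain ⟨y₁, h₁⟩ := (B.toDual hB).surjective ((finBasis ℂ V).coord (a 0))
  obtain ⟨y₂, h₂⟩ := (B.toDual hB).surjective ((finBasis ℂ V).coord (a 1))
  have ha : (fun i => (finBasis ℂ V).coord (a i)) = ![B y₁, B y₂] := by
    funext i
    fin_cases i
    exacts [h₁.symm, h₂.symm]
  rw [ha, evalMultivector_eq_contract, hv, LinearMap.zero_apply, map_zero]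

end Contraction

section ContractionLie

variable {g : Type*} [LieRing g] [LieAlgebra ℂ g] {B : LinearMap.BilinForm ℂ g}

theorem contract_adBivector (hB : B.lieInvariant g) (x : g) (v : ⋀[ℂ]^2 g) (y : g) :
    contract B (adBivector x v) y = ⁅x, contract B v y⁆ - contract B v ⁅x, y⁆ := by
  suffices (LinearMap.applyₗ y ∘ₗ contract B) ∘ₗ adBivector x =
      LieAlgebra.ad ℂ g x ∘ₗ LinearMap.applyₗ y ∘ₗ contract B -
        LinearMap.applyₗ ⁅x, y⁆ ∘ₗ contract B from LinearMap.congr_fun this v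
  refine bivector_hom_ext fun x₁ x₂ => ?_
  simp only [adBivector, LinearMap.coe_comp, Function.comp_apply, liftBilin_wedge₂,
    LinearMap.mk₂_apply, map_add, LinearMap.applyₗ_apply_apply, contract_wedge₂,
    LinearMap.sub_apply, LieAlgebra.ad_apply, lie_sub, lie_smul, hB x y, neg_smul,
    sub_neg_eq_add]
  abel

theorem evalMultivector_schouten (v w : ⋀[ℂ]^2 g) (y₁ y₂ y₃ : g) :
    evalMultivector ![B y₁, B y₂, B y₃] (schouten v w) =
      (B y₃ ⁅contract B v y₁, contract B w y₂⁆ - B y₃ ⁅contract B v y₂, contract B w y₁⁆) +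
      (B y₁ ⁅contract B v y₂, contract B w y₃⁆ - B y₁ ⁅contract B v y₃, contract B w y₂⁆) +
      (B y₂ ⁅contract B v y₃, contract B w y₁⁆ - B y₂ ⁅contract B v y₁, contract B w y₃⁆) := by
  let F (y y' y'' : g) : ⋀[ℂ]^2 g →ₗ[ℂ] ⋀[ℂ]^2 g →ₗ[ℂ] ℂ :=
    (LinearMap.mk₂ ℂ (fun x x' => B y'' ⁅x, x'⁆) (by simp) (by simp) (by simp) (by simp)).compl₁₂
      (LinearMap.applyₗ y ∘ₗ contract B) (LinearMap.applyₗ y' ∘ₗ contract B)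
  have F_apply (y y' y'' : g) (v w) :
      F y y' y'' v w = B y'' ⁅contract B v y, contract B w y'⁆ := rfl
  suffices schouten.compr₂ (evalMultivector ![B y₁, B y₂, B y₃]) =
      (F y₁ y₂ y₃ - F y₂ y₁ y₃) + (F y₂ y₃ y₁ - F y₃ y₂ y₁) + (F y₃ y₁ y₂ - F y₁ y₃ y₂) from
    LinearMap.congr_fun₂ this v w
  refine bivector_hom_ext fun x₁ x₂ => bivector_hom_ext fun x₃ x₄ => ?_
  simp only [LinearMap.compr₂_apply, schouten_wedge₂, schoutenDecomp, map_add, map_sub,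
    evalMultivector_wedge₃, LinearMap.add_apply, LinearMap.sub_apply, F_apply, contract_wedge₂,
    lie_sub, sub_lie, lie_smul, smul_lie, map_smul, smul_eq_mul]
  ring

theorem lie_cyclic_of_lieInvariant (hB : B.lieInvariant g) (hs : B.IsSymm) (x y z : g) :
    B x ⁅y, z⁆ = B y ⁅z, x⁆ := by
  rw [← lie_skew y z, map_neg, ← hB z x y, hs.eq]

theorem evalMultivector_schouten_self_of_eigenvectors (hB : B.lieInvariant g) (hs : B.IsSymm)
    {v : ⋀[ℂ]^2 g} {y₁ y₂ y₃ : g} {t₁ t₂ t₃ : ℂ} (h₁ : contract B v y₁ = t₁ • y₁)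
    (h₂ : contract B v y₂ = t₂ • y₂) (h₃ : contract B v y₃ = t₃ • y₃) :
    evalMultivector ![B y₁, B y₂, B y₃] (schouten v v) =
      2 * (t₁ * t₂ + t₂ * t₃ + t₃ * t₁) * B y₁ ⁅y₂, y₃⁆ := by
  rw [evalMultivector_schouten, h₁, h₂, h₃, ← lie_skew (t₂ • y₂) (t₁ • y₁),
    ← lie_skew (t₃ • y₃) (t₂ • y₂), ← lie_skew (t₁ • y₁) (t₃ • y₃)]
  simp only [smul_lie, lie_smul, map_smul, map_neg, smul_eq_mul]
  rw [← lie_cyclic_of_lieInvariant hB hs y₁ y₂ y₃, lie_cyclic_of_lieInvariant hB hs y₃ y₁ y₂]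
  ring

end ContractionLie

/-! ### Poisson brackets -/

section Poisson

variable {g : Type*} [LieRing g] [LieAlgebra ℂ g]
  {A : Type*} [CommRing A] [Algebra ℂ A] (ρ : g →ₗ⁅ℂ⁆ Derivation ℂ A A)

/-- The differential of `a`, as the map sending `x ∈ g` to the derivative of `a` along `x`. -/
def differential (a : A) : g →ₗ[ℂ] A :=
  LinearMap.mk₂ ℂ (fun a x => ρ x a) (by simp) (by simp) (by simp) (by simp) a

theorem differential_apply (a : A) (x : g) : differential ρ a x = ρ x a := rfl

/-- The bracket `bivectorBracket` as a bilinear map, depending linearly on the bivector. -/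
def bracketHom : ⋀[ℂ]^2 g →ₗ[ℂ] A →ₗ[ℂ] A →ₗ[ℂ] A :=
  liftBilin
    (LinearMap.mk₂ ℂ (fun x y => (LinearMap.mul ℂ A).compl₁₂ (ρ x : A →ₗ[ℂ] A) (ρ y : A →ₗ[ℂ] A) -
        (LinearMap.mul ℂ A).compl₁₂ (ρ y : A →ₗ[ℂ] A) (ρ x : A →ₗ[ℂ] A))
      (by intros; ext; simp; ring)
      (by intros; ext; simp [smul_sub])
      (by intros; ext; simp; ring)
      (by intros; ext; simp [smul_sub]))
    (fun x => LinearMap.ext₂ fun a b => by simp)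

theorem bracketHom_wedge₂ (a b : A) (x y : g) :
    bracketHom ρ (wedge₂ x y) a b = ρ x a * ρ y b - ρ y a * ρ x b := by
  simp [bracketHom, liftBilin_wedge₂]

theorem bivectorBracket_eq_bracketHom (v : ⋀[ℂ]^2 g) (a b : A) :
    bivectorBracket ρ v a b = bracketHom ρ v a b := by
  refine LinearMap.congr_fun (g := ((bracketHom ρ).flip a).flip b)
    (bivector_hom_ext fun x y => ?_) v
  rw [LinearMap.flip_apply, LinearMap.flip_apply, bracketHom_wedge₂]
  exact liftBilin_wedge₂ ..

theorem bracketHom_skew (v : ⋀[ℂ]^2 g) (a b : A) :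
    bracketHom ρ v a b = -bracketHom ρ v b a := by
  suffices ((bracketHom ρ).flip a).flip b = -((bracketHom ρ).flip b).flip a from
    LinearMap.congr_fun this v
  refine bivector_hom_ext fun x y => ?_
  simp only [LinearMap.flip_apply, bracketHom_wedge₂, LinearMap.neg_apply]
  ring

theorem bracketHom_mul (v : ⋀[ℂ]^2 g) (a b c : A) :
    bracketHom ρ v a (b * c) = bracketHom ρ v a b * c + b * bracketHom ρ v a c := by
  suffices ((bracketHom ρ).flip a).flip (b * c) =
      LinearMap.mulRight ℂ c ∘ₗ ((bracketHom ρ).flip a).flip b +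
        LinearMap.mulLeft ℂ b ∘ₗ ((bracketHom ρ).flip a).flip c from LinearMap.congr_fun this v
  refine bivector_hom_ext fun x y => ?_
  simp only [LinearMap.flip_apply, bracketHom_wedge₂, Derivation.leibniz, smul_eq_mul,
    LinearMap.add_apply, LinearMap.coe_comp, Function.comp_apply, LinearMap.mulRight_apply,
    LinearMap.mulLeft_apply]
  ring

theorem apply_bracketHom (x : g) (v : ⋀[ℂ]^2 g) (a b : A) :
    ρ x (bracketHom ρ v a b) = bracketHom ρ (adBivector x v) a b +
      bracketHom ρ v (ρ x a) b + bracketHom ρ v a (ρ x b) := by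
  let B (a b : A) : ⋀[ℂ]^2 g →ₗ[ℂ] A := ((bracketHom ρ).flip a).flip b
  suffices (ρ x : A →ₗ[ℂ] A) ∘ₗ B a b = B a b ∘ₗ adBivector x + B (ρ x a) b + B a (ρ x b) from
    LinearMap.congr_fun this v
  refine bivector_hom_ext fun y z => ?_
  simp only [B, adBivector, LinearMap.coe_comp, Derivation.coeFn_coe, Function.comp_apply,
    LinearMap.flip_apply, bracketHom_wedge₂, map_sub, Derivation.leibniz, smul_eq_mul,
    LinearMap.add_apply, liftBilin_wedge₂, LinearMap.mk₂_apply, map_add, LieHom.map_lie,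
    Derivation.commutator_apply]
  ring

theorem evalMultivector_differential_schouten (v w : ⋀[ℂ]^2 g) (a b c : A) :
    evalMultivector ![differential ρ a, differential ρ b, differential ρ c] (schouten v w) =
      (bracketHom ρ w a (bracketHom ρ v b c) + bracketHom ρ v a (bracketHom ρ w b c)) +
      (bracketHom ρ w b (bracketHom ρ v c a) + bracketHom ρ v b (bracketHom ρ w c a)) +
      (bracketHom ρ w c (bracketHom ρ v a b) + bracketHom ρ v c (bracketHom ρ w a b)) := by
  let F (a b c : A) : ⋀[ℂ]^2 g →ₗ[ℂ] ⋀[ℂ]^2 g →ₗ[ℂ] A :=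
    ((bracketHom ρ).flip a).flip ∘ₗ ((bracketHom ρ).flip b).flip c
  have F_apply (a b c : A) (v w) : F a b c v w = bracketHom ρ w a (bracketHom ρ v b c) := rfl
  suffices schouten.compr₂
      (evalMultivector ![differential ρ a, differential ρ b, differential ρ c]) =
      (F a b c + (F a b c).flip) + (F b c a + (F b c a).flip) + (F c a b + (F c a b).flip) from
    LinearMap.congr_fun₂ this v w
  refine bivector_hom_ext fun x₁ x₂ => bivector_hom_ext fun x₃ x₄ => ?_
  simp only [LinearMap.compr₂_apply, schouten_wedge₂, schoutenDecomp, map_add, map_sub,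
    evalMultivector_wedge₃, LinearMap.add_apply, LinearMap.flip_apply, F_apply, bracketHom_wedge₂,
    differential_apply, LieHom.map_lie, Derivation.commutator_apply, Derivation.leibniz,
    smul_eq_mul]
  ring

theorem bracketHom_jacobi_of_map_schouten_eq_zero {N : Submodule ℂ g} {v : ⋀[ℂ]^2 g}
    (hv : exteriorPower.map 3 N.mkQ (schouten v v) = 0) {a b c : A} (ha : ∀ x ∈ N, ρ x a = 0)
    (hb : ∀ x ∈ N, ρ x b = 0) (hc : ∀ x ∈ N, ρ x c = 0) :
    bracketHom ρ v a (bracketHom ρ v b c) + bracketHom ρ v b (bracketHom ρ v c a) +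
      bracketHom ρ v c (bracketHom ρ v a b) = 0 := by
  let f : Fin 3 → (g ⧸ N) →ₗ[ℂ] A := ![N.liftQ (differential ρ a) ha,
    N.liftQ (differential ρ b) hb, N.liftQ (differential ρ c) hc]
  have hf : (fun i => f i ∘ₗ N.mkQ) = ![differential ρ a, differential ρ b, differential ρ c] := by
    ext i
    fin_cases i <;> rfl
  have h := congrArg (evalMultivector f) hv
  rw [map_zero, evalMultivector_map, hf, evalMultivector_differential_schouten] at h
  suffices (2 : ℂ) • (bracketHom ρ v a (bracketHom ρ v b c) +
      bracketHom ρ v b (bracketHom ρ v c a) + bracketHom ρ v c (bracketHom ρ v a b)) = 0 from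
    (smul_eq_zero.1 this).resolve_left two_ne_zero
  rw [← h, two_smul]
  ring

theorem definesPoissonBracket [FiniteDimensional ℂ g] [LieAlgebra.IsKilling ℂ g]
    {H : LieSubalgebra ℂ g} [H.IsCartanSubalgebra] {Γ : Set H.root}
    {E : LieModule.Weight ℂ H g → g} {v : ⋀[ℂ]^2 g} (hinv : IsLeviInvariant E Γ v)
    (hv : toM E Γ (schouten v v) = 0) : DefinesPoissonBracket.{w} E Γ v := by
  intro A _ _ ρ
  have hbr : bivectorBracket ρ v = fun a b => bracketHom ρ v a b :=
    funext₂ (bivectorBracket_eq_bracketHom ρ v)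
  rw [hbr]
  exact
    { mem := fun a ha b hb x hx => by
        simp [apply_bracketHom, hinv x hx, ha x hx, hb x hx]
      add := fun a _ b _ c _ => map_add _ b c
      smul := fun t a _ b _ => map_smul _ t b
      skew := fun a _ b _ => bracketHom_skew ρ v a b
      leibniz := fun a _ b _ c _ => bracketHom_mul ρ v a b c
      jacobi := fun a ha b hb c hc =>
        bracketHom_jacobi_of_map_schouten_eq_zero ρ hv ha hb hc }

end Poisson

/-! ### Roots and root vectors -/

section RootStrings

open LieAlgebra LieModule

variable {K L : Type*} [Field K] [CharZero K] [LieRing L] [LieAlgebra K L] [FiniteDimensional K L]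
  [IsKilling K L] {H : LieSubalgebra K L} [H.IsCartanSubalgebra] [IsTriangularizable K H L]
  {α β : Weight K H L}

theorem exists_smul_eq_of_mem_rootSpace (hα : α.IsNonZero) {x y : L} (hx : x ∈ rootSpace H α)
    (hx0 : x ≠ 0) (hy : y ∈ rootSpace H α) : ∃ t : K, t • x = y := by
  obtain ⟨t, ht⟩ := (finrank_eq_one_iff_of_nonzero' (⟨x, hx⟩ : rootSpace H α)
    (by simpa using hx0)).mp (finrank_rootSpace_eq_one α hα) ⟨y, hy⟩
  exact ⟨t, congrArg Subtype.val ht⟩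

theorem chainTopCoeff_neg_lt_chainLength (hα : α.IsNonZero)
    (h : rootSpace H (α + β : H → K) ≠ ⊥) :
    chainTopCoeff (-α : Weight K H L) β < chainLength (-α) β := by
  have hbot : 1 ≤ chainBotCoeff (-α : Weight K H L) β := by
    have := ((rootSpace_zsmul_add_ne_bot_iff α β hα 1).mp (by rwa [one_smul])).1
    rw [Weight.coe_neg, chainBotCoeff_neg]
    exact_mod_cast this
  rw [← chainTopCoeff_add_chainBotCoeff]
  exact Nat.lt_add_of_pos_right hbot

-- The `α`-string through `β` is an irreducible `sl₂`-module whose lowest vector `z` (the top of the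
-- `-α`-string) is raised to weights `β` and `α + β` by `p` and `p + 1` applications of `f`.
theorem exists_lie_ne_zero_of_rootSpace_add_ne_bot (hα : α.IsNonZero)
    (h : rootSpace H (α + β : H → K) ≠ ⊥) :
    ∃ x ∈ rootSpace H α, ∃ y ∈ rootSpace H β, ⁅x, y⁆ ≠ 0 := by
  have hα' : (-α).IsNonZero := hα.neg
  obtain ⟨z, hz, hz0⟩ := (chainTop (-α : Weight K H L) β).exists_ne_zero
  obtain ⟨_, e, f, isSl2, he, hf⟩ := exists_isSl2Triple_of_weight_isNonZero hα'
  obtain rfl := isSl2.h_eq_coroot hα' he hf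
  have prim : isSl2.HasPrimitiveVectorWith z (chainLength (-α) β : K) :=
    have := lie_mem_genWeightSpace_of_mem_genWeightSpace he hz
    ⟨hz0, (chainLength_smul _ _ hz).symm, by rwa [genWeightSpace_add_chainTop _ _ hα'] at this⟩
  replace hf : f ∈ rootSpace H α := by simpa using hf
  set p := chainTopCoeff (-α : Weight K H L) β with hp
  have hmem : (toEnd K L L f ^ p) z ∈ rootSpace H β := by
    have := toEnd_pow_apply_mem hf hz p
    rwa [coe_chainTop', ← hp, Weight.coe_neg, smul_neg, add_neg_cancel_left] at this
  refine ⟨f, hf, _, hmem, ?_⟩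
  have := prim.pow_toEnd_f_ne_zero_of_eq_nat rfl (chainTopCoeff_neg_lt_chainLength hα h)
  rwa [← hp, pow_succ', Module.End.mul_apply] at this

theorem lie_ne_zero_of_rootSpace_add_ne_bot (hα : α.IsNonZero) (hβ : β.IsNonZero)
    (h : rootSpace H (α + β : H → K) ≠ ⊥) {x y : L} (hx : x ∈ rootSpace H α) (hx0 : x ≠ 0)
    (hy : y ∈ rootSpace H β) (hy0 : y ≠ 0) : ⁅x, y⁆ ≠ 0 := by
  obtain ⟨x', hx', y', hy', h'⟩ := exists_lie_ne_zero_of_rootSpace_add_ne_bot hα h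
  obtain ⟨s, rfl⟩ := exists_smul_eq_of_mem_rootSpace hα hx hx0 hx'
  obtain ⟨t, rfl⟩ := exists_smul_eq_of_mem_rootSpace hβ hy hy0 hy'
  rintro hxy
  simp [hxy] at h'

end RootStrings

variable {g : Type*} [LieRing g] [LieAlgebra ℂ g] [FiniteDimensional ℂ g]
  [LieAlgebra.IsKilling ℂ g]
  {H : LieSubalgebra ℂ g} [H.IsCartanSubalgebra]

section Roots

/-- The root `-α`. Unlike `RootPairing.indexNeg`, this makes `E (-α.1)` and `E (-α).1`
definitionally equal. -/
instance : InvolutiveNeg H.root where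
  neg α := ⟨-α.1, by simpa using LieSubalgebra.isNonZero_coe_root α⟩
  neg_neg α := Subtype.ext (neg_neg α.1)

theorem root_neg (α : H.root) : (rootSystem H).root (-α) = -(rootSystem H).root α := rfl

theorem isPos_neg_iff {b : (rootSystem H).Base} {α : H.root} : b.IsPos (-α) ↔ ¬ b.IsPos α := by
  have : -α = (rootSystem H).reflectionPerm α α := by
    apply (rootSystem H).root.injective
    rw [root_neg, RootPairing.root_reflectionPerm, RootPairing.reflection_apply_self]
  rw [this]
  exact RootPairing.Base.IsPos.neg_iff_not b α

theorem eq_zero_or_exists_root_eq {μ : Dual ℂ H} {x : g} (hx : x ∈ LieAlgebra.rootSpace H μ)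
    (hx0 : x ≠ 0) : μ = 0 ∨ ∃ α : H.root, (rootSystem H).root α = μ := by
  by_cases hμ : μ = 0
  · exact .inl hμ
  let W : LieModule.Weight ℂ H g :=
    ⟨μ, fun h => hx0 ((LieSubmodule.eq_bot_iff _).1 h x hx)⟩
  have hW : W.IsNonZero := fun h => hμ (DFunLike.coe_injective h)
  exact .inr ⟨⟨W, by simpa using hW⟩, rfl⟩

omit [LieAlgebra.IsKilling ℂ g] in
theorem mem_rootSpace_zero_iff {x : g} :
    x ∈ LieAlgebra.rootSpace H ((0 : Dual ℂ H) : H → ℂ) ↔ x ∈ H := by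
  change x ∈ LieAlgebra.rootSpace H (0 : H → ℂ) ↔ _
  simp [LieAlgebra.rootSpace_zero_eq]

omit [FiniteDimensional ℂ g] [LieAlgebra.IsKilling ℂ g] in
theorem lie_mem_rootSpace_add {x y : g} {μ ν : Dual ℂ H} (hx : x ∈ LieAlgebra.rootSpace H μ)
    (hy : y ∈ LieAlgebra.rootSpace H ν) :
    ⁅x, y⁆ ∈ LieAlgebra.rootSpace H ((μ + ν : Dual ℂ H) : H → ℂ) :=
  LieAlgebra.lie_mem_genWeightSpace_of_mem_genWeightSpace hx hy

omit [LieAlgebra.IsKilling ℂ g] in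
theorem killingForm_eq_zero_of_mem_rootSpace {μ ν : Dual ℂ H} {x y : g}
    (hx : x ∈ LieAlgebra.rootSpace H μ) (hy : y ∈ LieAlgebra.rootSpace H ν) (h : μ + ν ≠ 0) :
    killingForm ℂ g x y = 0 :=
  LieAlgebra.killingForm_apply_eq_zero_of_mem_rootSpace_of_add_ne_zero ℂ g H hx hy
    fun h0 => h (DFunLike.coe_injective h0)

end Roots

namespace IsRootVectors

variable {E : LieModule.Weight ℂ H g → g}

theorem mem_rootSpace (hE : IsRootVectors E) (α : H.root) :
    E α.1 ∈ LieAlgebra.rootSpace H ((rootSystem H).root α) :=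
  hE.mem _ (LieSubalgebra.isNonZero_coe_root α)

theorem killingForm_apply [DecidableEq H.root] (hE : IsRootVectors E) (α β : H.root) :
    killingForm ℂ g (E α.1) (E β.1) = if β = -α then 1 else 0 := by
  split_ifs with h
  · rw [h]
    exact hE.killing _ (LieSubalgebra.isNonZero_coe_root α)
  · refine killingForm_eq_zero_of_mem_rootSpace (hE.mem_rootSpace α) (hE.mem_rootSpace β)
      fun h0 => h ?_
    exact (rootSystem H).root.injective (eq_neg_of_add_eq_zero_right h0)

theorem ne_zero (hE : IsRootVectors E) (α : H.root) : E α.1 ≠ 0 := by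
  intro h
  simpa [h] using hE.killing _ (LieSubalgebra.isNonZero_coe_root α)

theorem exists_smul_eq (hE : IsRootVectors E) {α : H.root} {y : g}
    (hy : y ∈ LieAlgebra.rootSpace H ((rootSystem H).root α)) : ∃ t : ℂ, t • E α.1 = y :=
  exists_smul_eq_of_mem_rootSpace (LieSubalgebra.isNonZero_coe_root α) (hE.mem_rootSpace α)
    (hE.ne_zero α) hy

theorem exists_smul_lie_eq (hE : IsRootVectors E) {α β γ : H.root}
    (h : (rootSystem H).root γ = (rootSystem H).root α + (rootSystem H).root β) :
    ∃ t : ℂ, t • ⁅E α.1, E β.1⁆ = E γ.1 := by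
  have hγ : (γ.1 : H → ℂ) = α.1 + β.1 := congrArg DFunLike.coe h
  refine exists_smul_eq_of_mem_rootSpace (LieSubalgebra.isNonZero_coe_root γ) ?_ ?_
    (hE.mem_rootSpace γ)
  · have := lie_mem_rootSpace_add (hE.mem_rootSpace α) (hE.mem_rootSpace β)
    rwa [← h] at this
  · exact lie_ne_zero_of_rootSpace_add_ne_bot (LieSubalgebra.isNonZero_coe_root α)
      (LieSubalgebra.isNonZero_coe_root β) (hγ ▸ γ.1.genWeightSpace_ne_bot)
      (hE.mem_rootSpace α) (hE.ne_zero α) (hE.mem_rootSpace β) (hE.ne_zero β)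

theorem cartan_sup_span_eq_top (hE : IsRootVectors E) :
    H.toSubmodule ⊔ Submodule.span ℂ (Set.range fun α : H.root => E α.1) = ⊤ := by
  have h := congrArg LieSubmodule.toSubmodule
    (LieAlgebra.cartan_sup_iSup_rootSpace_eq_top (K := ℂ) H)
  rw [LieSubmodule.sup_toSubmodule, LieSubmodule.top_toSubmodule] at h
  rw [eq_top_iff, ← h]
  refine sup_le_sup le_rfl ?_
  simp only [LieSubmodule.iSup_toSubmodule]
  refine iSup_le fun α => iSup_le fun hα x hx => ?_
  obtain ⟨t, rfl⟩ := hE.exists_smul_eq (α := ⟨α, by simpa using hα⟩) hx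
  exact Submodule.smul_mem _ _ (Submodule.subset_span ⟨⟨α, by simpa using hα⟩, rfl⟩)

end IsRootVectors

/-! ### Quasiroots -/

section Quasiroots

variable {b : (rootSystem H).Base} {Γ : Set H.root}

theorem isPos_induction_on_add {p : H.root → Prop} (simple : ∀ i ∈ b.support, p i)
    (add : ∀ i j k, b.IsPos i → j ∈ b.support →
      (rootSystem H).root k = (rootSystem H).root i + (rootSystem H).root j → p i → p k)
    {α : H.root} (hα : b.IsPos α) : p α :=
  (RootPairing.Base.IsPos.induction_on_add (p := fun α => b.IsPos α ∧ p α) hα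
    (fun i hi => ⟨b.isPos_of_mem_support hi, simple i hi⟩)
    (fun i j k hk ih hj =>
      ⟨ih.1.add (b.isPos_of_mem_support hj) hk, add i j k ih.1 hj hk ih.2⟩)).2

theorem isOutside_iff {α : H.root} : IsOutside Γ α ↔ bar Γ α ≠ 0 := by
  simp [IsOutside, bar]

theorem bar_add {α β γ : H.root}
    (h : (rootSystem H).root γ = (rootSystem H).root α + (rootSystem H).root β) :
    bar Γ γ = bar Γ α + bar Γ β := by
  simp only [bar, h, map_add]

theorem bar_neg (α : H.root) : bar Γ (-α) = -bar Γ α := by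
  simp only [bar, root_neg, map_neg]

theorem bar_eq_zero_of_mem {α : H.root} (h : α ∈ Γ) : bar Γ α = 0 :=
  (Submodule.Quotient.mk_eq_zero _).2 (Submodule.subset_span ⟨α, h, rfl⟩)

theorem isOutside_neg_iff {α : H.root} : IsOutside Γ (-α) ↔ IsOutside Γ α := by
  simp [isOutside_iff, bar_neg]

theorem sum_decomposition (hΓ : Γ ⊆ b.support) (q : PosQuasiroot b Γ) :
    ((decomposition hΓ q).map fun i => (simpleQuasiroot hΓ i).1).sum = q.1 :=
  (existsUnique_decomposition hΓ q).choose_spec.1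

theorem eq_decomposition (hΓ : Γ ⊆ b.support) (q : PosQuasiroot b Γ)
    {s : Multiset (SimpleOutside b Γ)}
    (h : (s.map fun i => (simpleQuasiroot hΓ i).1).sum = q.1) : s = decomposition hΓ q :=
  (existsUnique_decomposition hΓ q).choose_spec.2 s h

theorem decomposition_simpleQuasiroot (hΓ : Γ ⊆ b.support) (i : SimpleOutside b Γ) :
    decomposition hΓ (simpleQuasiroot hΓ i) = {i} :=
  (eq_decomposition hΓ _ (by simp)).symm

theorem decomposition_add (hΓ : Γ ⊆ b.support) {p q r : PosQuasiroot b Γ}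
    (h : r.1 = p.1 + q.1) :
    decomposition hΓ r = decomposition hΓ p + decomposition hΓ q :=
  (eq_decomposition hΓ _ (by simp [sum_decomposition, h])).symm

theorem decomposition_ne_zero (hΓ : Γ ⊆ b.support) (q : PosQuasiroot b Γ) :
    decomposition hΓ q ≠ 0 := by
  intro h
  have := sum_decomposition hΓ q
  rw [h, Multiset.map_zero, Multiset.sum_zero] at this
  exact q.2.1 this.symm

theorem PosQuasiroot.ne_neg (hΓ : Γ ⊆ b.support) (p q : PosQuasiroot b Γ) : p.1 ≠ -q.1 := by
  intro h
  have hq : decomposition hΓ q + (decomposition hΓ p + decomposition hΓ q) =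
      decomposition hΓ q := eq_decomposition hΓ q (by simp [sum_decomposition, h])
  exact decomposition_ne_zero hΓ q (add_eq_zero.1 (add_eq_left.1 hq)).2

theorem isPos_of_bar_eq (hΓ : Γ ⊆ b.support) {α : H.root} (p : PosQuasiroot b Γ)
    (h : bar Γ α = p.1) : b.IsPos α := by
  by_contra hα
  refine PosQuasiroot.ne_neg hΓ ⟨-p.1, neg_ne_zero.2 p.2.1, -α, isPos_neg_iff.2 hα, ?_⟩ p rfl
  rw [bar_neg, h]

theorem PosQuasiroot.induction_on_add (hΓ : Γ ⊆ b.support) {P : PosQuasiroot b Γ → Prop}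
    (simple : ∀ i, P (simpleQuasiroot hΓ i))
    (add : ∀ (α : PosOutside b Γ) (i : SimpleOutside b Γ) (γ : PosOutside b Γ),
      (rootSystem H).root γ.1 = (rootSystem H).root α.1 + (rootSystem H).root i.1 →
      P α.bar → P γ.bar) (q : PosQuasiroot b Γ) : P q := by
  suffices ∀ α, b.IsPos α → ∀ h : b.IsPos α ∧ IsOutside Γ α, P (PosOutside.bar ⟨α, h⟩) by
    obtain ⟨_, hq, α, hα, rfl⟩ := q
    exact this α hα ⟨hα, isOutside_iff.2 hq⟩
  refine fun α => isPos_induction_on_add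
    (p := fun α => ∀ h : b.IsPos α ∧ IsOutside Γ α, P (PosOutside.bar ⟨α, h⟩)) ?_ ?_
  · intro i hi h
    have hiΓ : i ∉ Γ := fun hiΓ => isOutside_iff.1 h.2 (bar_eq_zero_of_mem hiΓ)
    exact simple ⟨i, hi, hiΓ⟩
  · intro i j k hi hj hk ih h
    have hbar : bar Γ k = bar Γ i + bar Γ j := bar_add hk
    by_cases hjΓ : j ∈ Γ
    · rw [bar_eq_zero_of_mem hjΓ, add_zero] at hbar
      have hi' : IsOutside Γ i := isOutside_iff.2 (hbar ▸ isOutside_iff.1 h.2)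
      have heq : PosOutside.bar ⟨k, h⟩ = PosOutside.bar (b := b) ⟨i, hi, hi'⟩ := Subtype.ext hbar
      exact heq ▸ ih ⟨hi, hi'⟩
    by_cases hi' : IsOutside Γ i
    · exact add ⟨i, hi, hi'⟩ ⟨j, hj, hjΓ⟩ ⟨k, h⟩ hk (ih ⟨hi, hi'⟩)
    · rw [isOutside_iff, not_not] at hi'
      rw [hi', zero_add] at hbar
      have heq : PosOutside.bar ⟨k, h⟩ = simpleQuasiroot hΓ ⟨j, hj, hjΓ⟩ := Subtype.ext hbar
      exact heq ▸ simple ⟨j, hj, hjΓ⟩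

instance : Finite (PosQuasiroot b Γ) := by
  have : Finite (PosOutside b Γ) := inferInstance
  refine Finite.of_surjective (PosOutside.bar (b := b) (Γ := Γ)) ?_
  rintro ⟨_, hq, α, hα, rfl⟩
  exact ⟨⟨α, hα, isOutside_iff.2 hq⟩, rfl⟩

end Quasiroots

/-! ### The Levi subalgebra and its complement -/

section Levi

variable {b : (rootSystem H).Base} {Γ : Set H.root} {E : LieModule.Weight ℂ H g → g}

theorem levi_induction (hE : IsRootVectors E) {p : g → Prop}
    (weight : ∀ μ ∈ hGamma Γ, ∀ x ∈ LieAlgebra.rootSpace H (μ : Dual ℂ H), p x)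
    (add : ∀ x y, p x → p y → p (x + y)) (smul : ∀ (t : ℂ) x, p x → p (t • x))
    (lie : ∀ x ∈ levi E Γ, ∀ y ∈ levi E Γ, p x → p y → p ⁅x, y⁆) {x : g}
    (hx : x ∈ levi E Γ) : p x := by
  induction hx using LieSubalgebra.lieSpan_induction with
  | zero => exact weight 0 (zero_mem _) 0 (zero_mem _)
  | add x y _ _ hx hy => exact add x y hx hy
  | smul t x _ hx => exact smul t x hx
  | lie x y hx hy hpx hpy => exact lie x hx y hy hpx hpy
  | mem x hx =>
    obtain hx | ⟨α, hα, hx⟩ := hx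
    · exact weight 0 (zero_mem _) x (mem_rootSpace_zero_iff.2 hx)
    · have hαΓ : (rootSystem H).root α ∈ hGamma Γ := Submodule.subset_span ⟨α, hα, rfl⟩
      obtain rfl | rfl := hx
      · exact weight _ hαΓ _ (hE.mem_rootSpace α)
      · exact weight _ (neg_mem hαΓ) _ (hE.mem_rootSpace (-α))

theorem rootVector_mem_levi_of_add (hE : IsRootVectors E) {α β γ : H.root}
    (h : (rootSystem H).root γ = (rootSystem H).root α + (rootSystem H).root β)
    (hα : E α.1 ∈ levi E Γ) (hβ : E β.1 ∈ levi E Γ) : E γ.1 ∈ levi E Γ := by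
  obtain ⟨t, ht⟩ := hE.exists_smul_lie_eq h
  exact ht ▸ (levi E Γ).smul_mem t ((levi E Γ).lie_mem hα hβ)

theorem mem_of_bar_add_eq_zero (hΓ : Γ ⊆ b.support) {α i : H.root} (hα : b.IsPos α)
    (hi : i ∈ b.support) (h : bar Γ α + bar Γ i = 0) : i ∈ Γ := by
  by_contra hiΓ
  have hneg : bar Γ (-α) = (simpleQuasiroot hΓ ⟨i, hi, hiΓ⟩).1 := by
    rw [bar_neg, neg_eq_of_add_eq_zero_right h]
    rfl
  exact isPos_neg_iff.1 (isPos_of_bar_eq hΓ _ hneg) hα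

theorem rootVector_mem_levi_of_isPos (hE : IsRootVectors E) (hΓ : Γ ⊆ b.support) {α : H.root}
    (hα : b.IsPos α) : bar Γ α = 0 → E α.1 ∈ levi E Γ ∧ E (-α).1 ∈ levi E Γ := by
  have mem_of_mem (i) (hi : i ∈ Γ) : E i.1 ∈ levi E Γ ∧ E (-i).1 ∈ levi E Γ :=
    ⟨LieSubalgebra.subset_lieSpan (.inr ⟨i, hi, .inl rfl⟩),
      LieSubalgebra.subset_lieSpan (.inr ⟨i, hi, .inr rfl⟩)⟩
  refine isPos_induction_on_add
    (p := fun α => bar Γ α = 0 → E α.1 ∈ levi E Γ ∧ E (-α).1 ∈ levi E Γ) ?_ ?_ hα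
  · intro i hi h0
    refine mem_of_mem i (not_not.1 fun hiΓ => ?_)
    exact isOutside_iff.1 (simple_isOutside hΓ ⟨i, hi, hiΓ⟩) h0
  · intro i j k hi hj hk ih h0
    rw [bar_add hk] at h0
    have hjΓ : j ∈ Γ := mem_of_bar_add_eq_zero hΓ hi hj h0
    rw [bar_eq_zero_of_mem hjΓ, add_zero] at h0
    have hk' : (rootSystem H).root (-k) = (rootSystem H).root (-i) + (rootSystem H).root (-j) := by
      simp only [root_neg, hk, neg_add]
    exact ⟨rootVector_mem_levi_of_add hE hk (ih h0).1 (mem_of_mem j hjΓ).1,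
      rootVector_mem_levi_of_add hE hk' (ih h0).2 (mem_of_mem j hjΓ).2⟩

theorem rootVector_mem_levi (hE : IsRootVectors E) (hΓ : Γ ⊆ b.support) {α : H.root}
    (hα : ¬ IsOutside Γ α) : E α.1 ∈ levi E Γ := by
  rw [isOutside_iff, not_not] at hα
  by_cases hpos : b.IsPos α
  · exact (rootVector_mem_levi_of_isPos hE hΓ hpos hα).1
  · have := (rootVector_mem_levi_of_isPos hE hΓ (isPos_neg_iff.2 hpos)
      (by rw [bar_neg, hα, neg_zero])).2
    rwa [neg_neg] at this

theorem levi_sup_mGamma_eq_top (hE : IsRootVectors E) (hΓ : Γ ⊆ b.support) :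
    (levi E Γ).toSubmodule ⊔ mGamma E Γ = ⊤ := by
  rw [eq_top_iff, ← hE.cartan_sup_span_eq_top, sup_le_iff, Submodule.span_le]
  refine ⟨le_sup_of_le_left fun x hx => LieSubalgebra.subset_lieSpan (.inl hx), ?_⟩
  rintro _ ⟨α, rfl⟩
  by_cases hα : IsOutside Γ α
  · exact Submodule.mem_sup_right (Submodule.subset_span ⟨α, hα, rfl⟩)
  · exact Submodule.mem_sup_left (rootVector_mem_levi hE hΓ hα)

theorem add_root_notMem_hGamma {μ : Dual ℂ H} (hμ : μ ∈ hGamma Γ) {γ : H.root}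
    (hγ : IsOutside Γ γ) : μ + (rootSystem H).root γ ∉ hGamma Γ :=
  fun h => hγ (((hGamma Γ).add_mem_iff_right hμ).1 h)

theorem lie_mem_mGamma_of_mem_rootSpace (hE : IsRootVectors E) {μ : Dual ℂ H}
    (hμ : μ ∈ hGamma Γ) {x : g} (hx : x ∈ LieAlgebra.rootSpace H μ) {y : g}
    (hy : y ∈ mGamma E Γ) : ⁅x, y⁆ ∈ mGamma E Γ := by
  suffices mGamma E Γ ≤ (mGamma E Γ).comap (LieAlgebra.ad ℂ g x) from this hy
  refine Submodule.span_le.2 ?_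
  rintro _ ⟨γ, hγ, rfl⟩
  change ⁅x, E γ.1⁆ ∈ mGamma E Γ
  have hmem := lie_mem_rootSpace_add hx (hE.mem_rootSpace γ)
  have hout := add_root_notMem_hGamma hμ hγ
  by_cases h0 : ⁅x, E γ.1⁆ = 0
  · exact h0 ▸ zero_mem _
  obtain hμγ | ⟨δ, hδ⟩ := eq_zero_or_exists_root_eq hmem h0
  · exact absurd (hμγ ▸ zero_mem _) hout
  rw [← hδ] at hmem hout
  obtain ⟨t, ht⟩ := hE.exists_smul_eq hmem
  exact ht ▸ Submodule.smul_mem _ t (Submodule.subset_span ⟨δ, hout, rfl⟩)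

theorem lie_mem_mGamma (hE : IsRootVectors E) {x : g} (hx : x ∈ levi E Γ) :
    ∀ {y}, y ∈ mGamma E Γ → ⁅x, y⁆ ∈ mGamma E Γ := by
  refine levi_induction (p := fun x => ∀ {y}, y ∈ mGamma E Γ → ⁅x, y⁆ ∈ mGamma E Γ) hE
    (fun _ hμ _ hx _ => lie_mem_mGamma_of_mem_rootSpace hE hμ hx) ?_ ?_ ?_ hx
  · intro x x' hx hx' y hy
    exact add_lie x x' y ▸ add_mem (hx hy) (hx' hy)
  · intro t x hx y hy
    exact smul_lie t x y ▸ Submodule.smul_mem _ t (hx hy)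
  · intro x _ x' _ hx hx' y hy
    exact lie_lie x x' y ▸ sub_mem (hx (hx' hy)) (hx' (hx hy))

theorem killingForm_eq_zero_of_mem_levi_of_mem_mGamma (hE : IsRootVectors E) {x : g}
    (hx : x ∈ levi E Γ) : ∀ {y}, y ∈ mGamma E Γ → killingForm ℂ g x y = 0 := by
  refine levi_induction (p := fun x => ∀ {y}, y ∈ mGamma E Γ → killingForm ℂ g x y = 0) hE
    ?_ ?_ ?_ ?_ hx
  · intro μ hμ x hx y hy
    suffices mGamma E Γ ≤ LinearMap.ker (killingForm ℂ g x) from this hy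
    refine Submodule.span_le.2 ?_
    rintro _ ⟨γ, hγ, rfl⟩
    refine killingForm_eq_zero_of_mem_rootSpace hx (hE.mem_rootSpace γ) fun h0 => ?_
    exact add_root_notMem_hGamma hμ hγ (h0 ▸ zero_mem _)
  · intro x x' hx hx' y hy
    rw [map_add, LinearMap.add_apply, hx hy, hx' hy, add_zero]
  · intro t x hx y hy
    rw [map_smul, LinearMap.smul_apply, hx hy, smul_zero]
  · intro x _ x' hx' hx _ y hy
    rw [LieModule.traceForm_apply_lie_apply]
    exact hx (lie_mem_mGamma hE hx' hy)

end Levi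

/-! ### Diagonal bivectors -/

section Diagonal

variable {b : (rootSystem H).Base} {Γ : Set H.root} {E : LieModule.Weight ℂ H g → g}

theorem contract_sum_rootVector (hE : IsRootVectors E) (c : H.root → ℂ) (γ : H.root) :
    contract (killingForm ℂ g) (∑ α : H.root, c α • wedge₂ (E α.1) (E (-α).1)) (E γ.1) =
      (c γ - c (-γ)) • E γ.1 := by
  classical
  have hterm (α : H.root) : (c α • contract (killingForm ℂ g) (wedge₂ (E α.1) (E (-α).1))) (E γ.1) =
      (if α = γ then c γ • E γ.1 else 0) - if α = -γ then c (-γ) • E γ.1 else 0 := by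
    rw [LinearMap.smul_apply, contract_wedge₂, hE.killingForm_apply, hE.killingForm_apply]
    simp only [neg_inj, smul_sub]
    congr 1 <;> split_ifs with h <;> simp [h]
  simp only [map_sum, map_smul, LinearMap.sum_apply, hterm, Finset.sum_sub_distrib,
    Finset.sum_ite_eq', Finset.mem_univ, if_true, sub_smul]

theorem contract_sum_eq_zero_of_mem_cartan (hE : IsRootVectors E) (c : H.root → ℂ) {x : g}
    (hx : x ∈ H) :
    contract (killingForm ℂ g) (∑ α : H.root, c α • wedge₂ (E α.1) (E (-α).1)) x = 0 := by
  have hzero (α : H.root) : killingForm ℂ g x (E α.1) = 0 :=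
    killingForm_eq_zero_of_mem_rootSpace (mem_rootSpace_zero_iff.2 hx) (hE.mem_rootSpace α)
      (by rw [zero_add]; exact (rootSystem H).ne_zero α)
  simp only [map_sum, map_smul, LinearMap.sum_apply, LinearMap.smul_apply, contract_wedge₂, hzero,
    zero_smul, sub_zero, smul_zero, Finset.sum_const_zero]

open Classical in
theorem rMatrix_eq_sum :
    rMatrix E b =
      ∑ α : H.root, (if b.IsPos α then 1 else 0 : ℂ) • wedge₂ (E α.1) (E (-α).1) := by
  simp only [ite_smul, one_smul, zero_smul, ← Finset.sum_filter]
  exact (Finset.sum_subtype _ (by simp) fun α : H.root => wedge₂ (E α.1) (E (-α).1)).symm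

open Classical in
theorem contract_rMatrix (hE : IsRootVectors E) (γ : H.root) :
    contract (killingForm ℂ g) (rMatrix E b) (E γ.1) =
      (if b.IsPos γ then 1 else -1 : ℂ) • E γ.1 := by
  rw [rMatrix_eq_sum, contract_sum_rootVector hE]
  congr 1
  by_cases h : b.IsPos γ <;> simp [isPos_neg_iff, h]

/-- Coefficients at the positive quasiroots, extended by zero to `h*/h*_Γ`. -/
def extendByZero (d : PosQuasiroot b Γ → ℂ) : Dual ℂ H ⧸ hGamma Γ → ℂ :=
  Function.extend Subtype.val d 0

theorem extendByZero_bar (d : PosQuasiroot b Γ → ℂ) (α : PosOutside b Γ) :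
    extendByZero d (bar Γ α.1) = d α.bar :=
  Subtype.val_injective.extend_apply d 0 α.bar

theorem extendByZero_eq_zero (hΓ : Γ ⊆ b.support) (d : PosQuasiroot b Γ → ℂ) {α : H.root}
    (hα : ¬ (b.IsPos α ∧ IsOutside Γ α)) : extendByZero d (bar Γ α) = 0 := by
  refine Function.extend_apply' _ _ _ ?_
  rintro ⟨q, hq⟩
  exact hα ⟨isPos_of_bar_eq hΓ q hq.symm, isOutside_iff.2 (hq ▸ q.2.1)⟩

theorem bivector_eq_sum (hΓ : Γ ⊆ b.support) (d : PosQuasiroot b Γ → ℂ) :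
    bivector E d = ∑ α : H.root, extendByZero d (bar Γ α) • wedge₂ (E α.1) (E (-α).1) := by
  classical
  let f (α : H.root) : ⋀[ℂ]^2 g := extendByZero d (bar Γ α) • wedge₂ (E α.1) (E (-α).1)
  have hf (α : H.root) : ¬ (b.IsPos α ∧ IsOutside Γ α) → f α = 0 := fun hα => by
    simp only [f, extendByZero_eq_zero hΓ d hα, zero_smul]
  let _ := Fintype.ofFinite (PosOutside b Γ)
  calc bivector E d = ∑ α : PosOutside b Γ, f α.1 :=
        Fintype.sum_congr _ _ fun α => congrArg (· • _) (extendByZero_bar d α).symm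
    _ = ∑ α with b.IsPos α ∧ IsOutside Γ α, f α := (Finset.sum_subtype _ (by simp) f).symm
    _ = ∑ α, f α := Finset.sum_filter_of_ne fun α _ h => not_not.1 (mt (hf α) h)

/-- The eigenvalues of the contraction of `∑ c(ᾱ) E_α ∧ E_{-α}`, as a function of the weight
modulo `h*_Γ`: they extend `c` to an odd function on the quasiroots. -/
def eigenvalue (d : PosQuasiroot b Γ → ℂ) (q : Dual ℂ H ⧸ hGamma Γ) : ℂ :=
  extendByZero d q - extendByZero d (-q)

theorem eigenvalue_zero (d : PosQuasiroot b Γ → ℂ) : eigenvalue d 0 = 0 := by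
  rw [eigenvalue, neg_zero, sub_self]

theorem eigenvalue_neg (d : PosQuasiroot b Γ → ℂ) (q : Dual ℂ H ⧸ hGamma Γ) :
    eigenvalue d (-q) = -eigenvalue d q := by
  rw [eigenvalue, eigenvalue, neg_neg, neg_sub]

theorem eigenvalue_bar (hΓ : Γ ⊆ b.support) (d : PosQuasiroot b Γ → ℂ) (α : PosOutside b Γ) :
    eigenvalue d (bar Γ α.1) = d α.bar := by
  rw [eigenvalue, ← bar_neg, extendByZero_bar,
    extendByZero_eq_zero hΓ d fun h => isPos_neg_iff.1 h.1 α.2.1, sub_zero]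

theorem contract_bivector_rootVector (hE : IsRootVectors E) (hΓ : Γ ⊆ b.support)
    (d : PosQuasiroot b Γ → ℂ) (γ : H.root) :
    contract (killingForm ℂ g) (bivector E d) (E γ.1) = eigenvalue d (bar Γ γ) • E γ.1 := by
  rw [bivector_eq_sum hΓ, contract_sum_rootVector hE, bar_neg, eigenvalue]

theorem contract_bivector (hE : IsRootVectors E) (hΓ : Γ ⊆ b.support)
    (d : PosQuasiroot b Γ → ℂ) {μ : Dual ℂ H} {x : g} (hx : x ∈ LieAlgebra.rootSpace H μ) :
    contract (killingForm ℂ g) (bivector E d) x = eigenvalue d ((hGamma Γ).mkQ μ) • x := by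
  by_cases hx0 : x = 0
  · rw [hx0, map_zero, smul_zero]
  obtain rfl | ⟨γ, rfl⟩ := eq_zero_or_exists_root_eq hx hx0
  · rw [bivector_eq_sum hΓ, contract_sum_eq_zero_of_mem_cartan hE _ (mem_rootSpace_zero_iff.1 hx),
      map_zero, eigenvalue_zero, zero_smul]
  · obtain ⟨t, rfl⟩ := hE.exists_smul_eq hx
    rw [map_smul, contract_bivector_rootVector hE hΓ, smul_comm, bar]

theorem bivector_mem_bivectorsInM (d : PosQuasiroot b Γ → ℂ) :
    bivector E d ∈ bivectorsInM E Γ := by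
  refine Submodule.sum_mem _ fun α _ => Submodule.smul_mem _ _ ?_
  refine ⟨wedge₂ ⟨E α.1.1, Submodule.subset_span ⟨α.1, α.2.2, rfl⟩⟩
    ⟨E (-α.1).1, Submodule.subset_span ⟨-α.1, isOutside_neg_iff.2 α.2.2, rfl⟩⟩, ?_⟩
  rw [wedge₂, exteriorPower.map_apply_ιMulti, wedge₂]
  congr 1
  funext k
  fin_cases k <;> rfl

theorem bivector_injective (hE : IsRootVectors E) (hΓ : Γ ⊆ b.support) :
    Function.Injective (bivector E : (PosQuasiroot b Γ → ℂ) → ⋀[ℂ]^2 g) := by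
  rintro d d' h
  funext q
  obtain ⟨_, hq, α, hα, rfl⟩ := q
  let α' : PosOutside b Γ := ⟨α, hα, isOutside_iff.2 hq⟩
  have heq : eigenvalue d (bar Γ α) • E α.1 = eigenvalue d' (bar Γ α) • E α.1 := by
    rw [← contract_bivector_rootVector hE hΓ, h, contract_bivector_rootVector hE hΓ]
  calc d α'.bar = eigenvalue d (bar Γ α) := (eigenvalue_bar hΓ d α').symm
    _ = eigenvalue d' (bar Γ α) := smul_left_injective ℂ (hE.ne_zero α) heq
    _ = d' α'.bar := eigenvalue_bar hΓ d' α'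

theorem contract_bivector_lie_of_mem_rootSpace (hE : IsRootVectors E) (hΓ : Γ ⊆ b.support)
    (d : PosQuasiroot b Γ → ℂ) {μ : Dual ℂ H} (hμ : μ ∈ hGamma Γ) {x : g}
    (hx : x ∈ LieAlgebra.rootSpace H μ) (y : g) :
    contract (killingForm ℂ g) (bivector E d) ⁅x, y⁆ =
      ⁅x, contract (killingForm ℂ g) (bivector E d) y⁆ := by
  have hweight (ν : Dual ℂ H) (y : g) (hy : y ∈ LieAlgebra.rootSpace H ν) :
      contract (killingForm ℂ g) (bivector E d) ⁅x, y⁆ =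
        ⁅x, contract (killingForm ℂ g) (bivector E d) y⁆ := by
    have hμ0 : (hGamma Γ).mkQ μ = 0 := (Submodule.Quotient.mk_eq_zero _).2 hμ
    rw [contract_bivector hE hΓ d (lie_mem_rootSpace_add hx hy), contract_bivector hE hΓ d hy,
      lie_smul, map_add, hμ0, zero_add]
  suffices (⊤ : Submodule ℂ g) ≤
      LinearMap.eqLocus (contract (killingForm ℂ g) (bivector E d) ∘ₗ LieAlgebra.ad ℂ g x)
        (LieAlgebra.ad ℂ g x ∘ₗ contract (killingForm ℂ g) (bivector E d)) from
    this (Submodule.mem_top (x := y))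
  rw [← hE.cartan_sup_span_eq_top, sup_le_iff, Submodule.span_le]
  refine ⟨fun y hy => hweight 0 y (mem_rootSpace_zero_iff.2 hy), ?_⟩
  rintro _ ⟨α, rfl⟩
  exact hweight _ _ (hE.mem_rootSpace α)

theorem contract_bivector_lie (hE : IsRootVectors E) (hΓ : Γ ⊆ b.support)
    (d : PosQuasiroot b Γ → ℂ) {x : g} (hx : x ∈ levi E Γ) :
    ∀ y, contract (killingForm ℂ g) (bivector E d) ⁅x, y⁆ =
      ⁅x, contract (killingForm ℂ g) (bivector E d) y⁆ := by
  refine levi_induction (p := fun x => ∀ y, contract (killingForm ℂ g) (bivector E d) ⁅x, y⁆ =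
    ⁅x, contract (killingForm ℂ g) (bivector E d) y⁆) hE
    (fun _ hμ _ hx => contract_bivector_lie_of_mem_rootSpace hE hΓ d hμ hx) ?_ ?_ ?_ hx
  · intro x x' hx hx' y
    rw [add_lie, map_add, hx, hx', add_lie]
  · intro t x hx y
    rw [smul_lie, map_smul, hx, smul_lie]
  · intro x _ x' _ hx hx' y
    rw [lie_lie, map_sub, hx, hx', hx', hx, lie_lie]

theorem bivector_isLeviInvariant (hE : IsRootVectors E) (hΓ : Γ ⊆ b.support)
    (d : PosQuasiroot b Γ → ℂ) : IsLeviInvariant E Γ (bivector E d) := by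
  intro x hx
  refine contract_injective (killingForm_nondegenerate ℂ g) (LinearMap.ext fun y => ?_)
  rw [contract_adBivector (LieModule.traceForm_lieInvariant ℂ g g),
    contract_bivector_lie hE hΓ d hx, sub_self, map_zero, LinearMap.zero_apply]

end Diagonal

/-! ### The Schouten equation in terms of the coefficients -/

section Equation

variable {b : (rootSystem H).Base} {Γ : Set H.root} {E : LieModule.Weight ℂ H g → g}

/-- The functional on `g/g_Γ` induced by `(E_{-α}, ·)`; these functionals are dual to the classes
of the `E_α`. -/
def rootFunctional (hE : IsRootVectors E) (α : {α : H.root // IsOutside Γ α}) :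
    Dual ℂ (g ⧸ (levi E Γ).toSubmodule) :=
  (levi E Γ).toSubmodule.liftQ (killingForm ℂ g (E (-α.1).1)) fun x hx => by
    rw [LinearMap.mem_ker, LieModule.traceForm_comm]
    exact killingForm_eq_zero_of_mem_levi_of_mem_mGamma hE hx
      (Submodule.subset_span ⟨-α.1, isOutside_neg_iff.2 α.2, rfl⟩)

open Classical in
theorem rootFunctional_mkQ_rootVector (hE : IsRootVectors E)
    (α β : {α : H.root // IsOutside Γ α}) :
    rootFunctional hE α ((levi E Γ).toSubmodule.mkQ (E β.1.1)) = if β = α then 1 else 0 := by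
  rw [rootFunctional, Submodule.mkQ_apply, Submodule.liftQ_apply, hE.killingForm_apply, neg_neg]
  simp only [Subtype.ext_iff]

/-- The basis of `g/g_Γ` consisting of the classes of the `E_α`, `α ∈ Ω ∖ Ω_Γ`. -/
def quotientBasis (hE : IsRootVectors E) (hΓ : Γ ⊆ b.support) :
    Basis {α : H.root // IsOutside Γ α} ℂ (g ⧸ (levi E Γ).toSubmodule) :=
  Basis.mk (v := fun α => (levi E Γ).toSubmodule.mkQ (E α.1.1))
    (LinearIndependent.of_pairwise_dual_eq_zero_one _ (rootFunctional hE)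
      (fun α β h => (rootFunctional_mkQ_rootVector hE α β).trans (if_neg h.symm))
      (fun α => (rootFunctional_mkQ_rootVector hE α α).trans (if_pos rfl)))
    (by
      have h := congrArg (Submodule.map (levi E Γ).toSubmodule.mkQ) (levi_sup_mGamma_eq_top hE hΓ)
      rw [Submodule.map_sup, Submodule.mkQ_map_self, bot_sup_eq, Submodule.map_top,
        Submodule.range_mkQ, mGamma, Submodule.map_span] at h
      rw [← h]
      refine Submodule.span_mono ?_
      rintro _ ⟨_, ⟨α, hα, rfl⟩, rfl⟩
      exact ⟨⟨α, hα⟩, rfl⟩)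

theorem quotientBasis_coord (hE : IsRootVectors E) (hΓ : Γ ⊆ b.support)
    (α : {α : H.root // IsOutside Γ α}) : (quotientBasis hE hΓ).coord α = rootFunctional hE α := by
  classical
  refine (quotientBasis hE hΓ).ext fun β => ?_
  rw [Basis.coord_apply, Basis.repr_self, Finsupp.single_apply, quotientBasis, Basis.mk_apply,
    rootFunctional_mkQ_rootVector]

theorem toM_eq_zero_iff (hE : IsRootVectors E) (hΓ : Γ ⊆ b.support) (w : ⋀[ℂ]^3 g) :
    toM E Γ w = 0 ↔ ∀ α β γ : H.root, IsOutside Γ α → IsOutside Γ β → IsOutside Γ γ →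
      evalMultivector ![killingForm ℂ g (E α.1), killingForm ℂ g (E β.1),
        killingForm ℂ g (E γ.1)] w = 0 := by
  have heval (α β γ : {α : H.root // IsOutside Γ α}) :
      evalMultivector ![rootFunctional hE α, rootFunctional hE β, rootFunctional hE γ]
          (toM E Γ w) =
        evalMultivector ![killingForm ℂ g (E (-α.1).1), killingForm ℂ g (E (-β.1).1),
          killingForm ℂ g (E (-γ.1).1)] w := by
    rw [toM, evalMultivector_map]
    congr 2
    funext i
    fin_cases i <;> exact Submodule.liftQ_mkQ _ _ _
  constructor
  · intro h α β γ hα hβ hγ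
    have := heval ⟨-α, isOutside_neg_iff.2 hα⟩ ⟨-β, isOutside_neg_iff.2 hβ⟩
      ⟨-γ, isOutside_neg_iff.2 hγ⟩
    simpa only [h, map_zero, neg_neg] using this.symm
  · intro h
    refine eq_zero_of_evalMultivector_coord (quotientBasis hE hΓ) fun a => ?_
    have ha : (fun i => (quotientBasis hE hΓ).coord (a i)) =
        ![rootFunctional hE (a 0), rootFunctional hE (a 1), rootFunctional hE (a 2)] := by
      funext i
      fin_cases i <;> exact quotientBasis_coord hE hΓ _
    rw [ha, heval]
    exact h _ _ _ (isOutside_neg_iff.2 (a 0).2) (isOutside_neg_iff.2 (a 1).2)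
      (isOutside_neg_iff.2 (a 2).2)

theorem killingForm_lie_ne_zero_iff (hE : IsRootVectors E) {α β γ : H.root} :
    killingForm ℂ g (E α.1) ⁅E β.1, E γ.1⁆ ≠ 0 ↔
      (rootSystem H).root α + (rootSystem H).root β + (rootSystem H).root γ = 0 := by
  classical
  constructor
  · refine not_imp_comm.1 fun h => ?_
    exact killingForm_eq_zero_of_mem_rootSpace (hE.mem_rootSpace α)
      (lie_mem_rootSpace_add (hE.mem_rootSpace β) (hE.mem_rootSpace γ)) (by rwa [← add_assoc])
  · intro h h0
    have hα : (rootSystem H).root (-α) = (rootSystem H).root β + (rootSystem H).root γ := by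
      rw [root_neg, neg_eq_iff_add_eq_zero, ← add_assoc, h]
    obtain ⟨t, ht⟩ := hE.exists_smul_lie_eq hα
    have hone := hE.killingForm_apply α (-α)
    rw [if_pos rfl, ← ht, map_smul, h0, smul_zero] at hone
    exact zero_ne_one hone

theorem not_isPos_of_add_add_eq_zero {α β γ : H.root} (hα : b.IsPos α) (hβ : b.IsPos β)
    (h : (rootSystem H).root α + (rootSystem H).root β + (rootSystem H).root γ = 0) :
    ¬ b.IsPos γ := by
  refine isPos_neg_iff.1 (RootPairing.Base.IsPos.add hα hβ ?_)
  rw [root_neg, neg_eq_iff_add_eq_zero, add_comm, h]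

theorem root_neg_add_add_eq_zero {α β γ : H.root}
    (h : (rootSystem H).root α + (rootSystem H).root β + (rootSystem H).root γ = 0) :
    (rootSystem H).root (-α) + (rootSystem H).root (-β) + (rootSystem H).root (-γ) = 0 := by
  rw [root_neg, root_neg, root_neg, ← neg_add, ← neg_add, h, neg_zero]

theorem isPos_of_add_add_eq_zero {α β γ : H.root} (hα : ¬ b.IsPos α) (hβ : ¬ b.IsPos β)
    (h : (rootSystem H).root α + (rootSystem H).root β + (rootSystem H).root γ = 0) :
    b.IsPos γ :=
  not_not.1 <| isPos_neg_iff.not.1 <| not_isPos_of_add_add_eq_zero (isPos_neg_iff.2 hα)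
    (isPos_neg_iff.2 hβ) (root_neg_add_add_eq_zero h)

open Classical in
theorem sign_mul_add_of_add_add_eq_zero {α β γ : H.root}
    (h : (rootSystem H).root α + (rootSystem H).root β + (rootSystem H).root γ = 0) :
    ((if b.IsPos α then 1 else -1) * (if b.IsPos β then 1 else -1) +
      (if b.IsPos β then 1 else -1) * (if b.IsPos γ then 1 else -1) +
      (if b.IsPos γ then 1 else -1) * (if b.IsPos α then 1 else -1) : ℂ) = -1 := by
  by_cases hα : b.IsPos α <;> by_cases hβ : b.IsPos β
  · simp [hα, hβ, not_isPos_of_add_add_eq_zero hα hβ h]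
  · split_ifs <;> ring
  · split_ifs <;> ring
  · simp [hα, hβ, isPos_of_add_add_eq_zero hα hβ h]

theorem satisfiesSchouten_iff_of_add_add_eq_zero (hE : IsRootVectors E) (hΓ : Γ ⊆ b.support)
    (K : ℂ) (d : PosQuasiroot b Γ → ℂ) :
    SatisfiesSchouten E b Γ K (bivector E d) ↔
      ∀ α β γ : H.root, IsOutside Γ α → IsOutside Γ β → IsOutside Γ γ →
        (rootSystem H).root α + (rootSystem H).root β + (rootSystem H).root γ = 0 →
        eigenvalue d (bar Γ α) * eigenvalue d (bar Γ β) +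
          eigenvalue d (bar Γ β) * eigenvalue d (bar Γ γ) +
          eigenvalue d (bar Γ γ) * eigenvalue d (bar Γ α) = -K ^ 2 := by
  classical
  have hinv : (killingForm ℂ g).lieInvariant g := LieModule.traceForm_lieInvariant ℂ g g
  have hsymm : (killingForm ℂ g).IsSymm := ⟨LieModule.traceForm_comm ℂ g g⟩
  have hv := contract_bivector_rootVector hE hΓ d
  have hr := contract_rMatrix (b := b) hE
  rw [SatisfiesSchouten, phiM, ← map_smul, ← sub_eq_zero, ← map_sub, toM_eq_zero_iff hE hΓ]
  refine forall₃_congr fun α β γ => forall₃_congr fun _ _ _ => ?_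
  rw [map_sub, map_smul, smul_eq_mul,
    evalMultivector_schouten_self_of_eigenvectors hinv hsymm (hv α) (hv β) (hv γ),
    evalMultivector_schouten_self_of_eigenvectors hinv hsymm (hr α) (hr β) (hr γ)]
  by_cases h : (rootSystem H).root α + (rootSystem H).root β + (rootSystem H).root γ = 0
  · rw [sign_mul_add_of_add_add_eq_zero h, ← mul_assoc, ← sub_mul, mul_eq_zero,
      or_iff_left ((killingForm_lie_ne_zero_iff hE).2 h), forall_prop_of_true h]
    exact ⟨fun heq => by linear_combination heq / 2, fun heq => by linear_combination 2 * heq⟩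
  · have h0 := not_not.1 (mt (killingForm_lie_ne_zero_iff hE).1 h)
    simp only [h0, mul_zero, sub_zero, h, false_imp_iff]

theorem add_add_eq_zero_induction {P : H.root → H.root → H.root → Prop}
    (pos : ∀ α β γ, b.IsPos α → b.IsPos β →
      (rootSystem H).root α + (rootSystem H).root β + (rootSystem H).root γ = 0 → P α β γ)
    (neg : ∀ α β γ, P (-α) (-β) (-γ) → P α β γ) (rotate : ∀ α β γ, P β γ α → P α β γ)
    {α β γ : H.root}
    (h : (rootSystem H).root α + (rootSystem H).root β + (rootSystem H).root γ = 0) :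
    P α β γ := by
  have of_isPos_iff {α β γ : H.root}
      (h : (rootSystem H).root α + (rootSystem H).root β + (rootSystem H).root γ = 0)
      (hαβ : b.IsPos α ↔ b.IsPos β) : P α β γ := by
    by_cases hα : b.IsPos α
    · exact pos α β γ hα (hαβ.1 hα) h
    · exact neg α β γ (pos _ _ _ (isPos_neg_iff.2 hα) (isPos_neg_iff.2 (mt hαβ.2 hα))
        (root_neg_add_add_eq_zero h))
  have hagree : (b.IsPos α ↔ b.IsPos β) ∨ (b.IsPos β ↔ b.IsPos γ) ∨ (b.IsPos γ ↔ b.IsPos α) := by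
    tauto
  obtain hαβ | hβγ | hγα := hagree
  · exact of_isPos_iff h hαβ
  · exact rotate _ _ _ (of_isPos_iff (by rw [← h]; abel) hβγ)
  · exact rotate _ _ _ (rotate _ _ _ (of_isPos_iff (by rw [← h]; abel) hγα))

theorem satisfiesSchouten_iff (hE : IsRootVectors E) (hΓ : Γ ⊆ b.support) (K : ℂ)
    (d : PosQuasiroot b Γ → ℂ) :
    SatisfiesSchouten E b Γ K (bivector E d) ↔
      ∀ α β γ : PosOutside b Γ,
        (rootSystem H).root γ.1 = (rootSystem H).root α.1 + (rootSystem H).root β.1 →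
        d γ.bar * (d α.bar + d β.bar) = d α.bar * d β.bar + K ^ 2 := by
  have eigenvalue_bar_neg (α : H.root) :
      eigenvalue d (bar Γ (-α)) = -eigenvalue d (bar Γ α) := by rw [bar_neg, eigenvalue_neg]
  rw [satisfiesSchouten_iff_of_add_add_eq_zero hE hΓ]
  constructor
  · intro h α β γ hγ
    have := h α.1 β.1 (-γ.1) α.2.2 β.2.2 (isOutside_neg_iff.2 γ.2.2)
      (by rw [root_neg, hγ, add_neg_cancel])
    rw [eigenvalue_bar_neg, eigenvalue_bar hΓ, eigenvalue_bar hΓ, eigenvalue_bar hΓ] at this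
    linear_combination -this
  · intro h α β γ hα hβ hγ h0
    refine add_add_eq_zero_induction (b := b)
      (P := fun α β γ => IsOutside Γ α → IsOutside Γ β → IsOutside Γ γ →
        eigenvalue d (bar Γ α) * eigenvalue d (bar Γ β) +
          eigenvalue d (bar Γ β) * eigenvalue d (bar Γ γ) +
          eigenvalue d (bar Γ γ) * eigenvalue d (bar Γ α) = -K ^ 2)
      ?pos ?neg ?rotate h0 hα hβ hγ
    case pos =>
      intro α β γ hαpos hβpos h0 hα hβ hγ
      let α' : PosOutside b Γ := ⟨α, hαpos, hα⟩
      let β' : PosOutside b Γ := ⟨β, hβpos, hβ⟩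
      let γ' : PosOutside b Γ :=
        ⟨-γ, isPos_neg_iff.2 (not_isPos_of_add_add_eq_zero hαpos hβpos h0), isOutside_neg_iff.2 hγ⟩
      have hadd := h α' β' γ' (by rw [root_neg, neg_eq_iff_add_eq_zero, add_comm, h0])
      rw [← eigenvalue_bar hΓ d α', ← eigenvalue_bar hΓ d β', ← eigenvalue_bar hΓ d γ',
        eigenvalue_bar_neg] at hadd
      linear_combination -hadd
    case neg =>
      intro α β γ ih hα hβ hγ
      simpa only [eigenvalue_bar_neg, neg_mul_neg] using
        ih (isOutside_neg_iff.2 hα) (isOutside_neg_iff.2 hβ) (isOutside_neg_iff.2 hγ)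
    case rotate => exact fun α β γ ih hα hβ hγ => by linear_combination ih hβ hγ hα

end Equation

/-! ### Solutions of the coefficient equations -/

section Solutions

variable {b : (rootSystem H).Base} {Γ : Set H.root} {E : LieModule.Weight ℂ H g → g}

theorem ne_zero_and_inv_eq_of_mul_add_eq_mul {F : Type*} [Field F] {x y z : F} (hx : x ≠ 0)
    (hy : y ≠ 0) (h : z * (x + y) = x * y) : z ≠ 0 ∧ z⁻¹ = x⁻¹ + y⁻¹ := by
  have hz : z ≠ 0 := left_ne_zero_of_mul (h ▸ mul_ne_zero hx hy)
  refine ⟨hz, ?_⟩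
  field_simp
  linear_combination -h

theorem simpleValues_simpleQuasiroot (hΓ : Γ ⊆ b.support) (c : SimpleOutside b Γ → ℂ)
    (i : SimpleOutside b Γ) : simpleValues hΓ c (simpleQuasiroot hΓ i) = {c i} := by
  rw [simpleValues, decomposition_simpleQuasiroot, Multiset.map_singleton]

theorem simpleValues_add (hΓ : Γ ⊆ b.support) (c : SimpleOutside b Γ → ℂ)
    {p q r : PosQuasiroot b Γ} (h : r.1 = p.1 + q.1) :
    simpleValues hΓ c r = simpleValues hΓ c p + simpleValues hΓ c q := by
  rw [simpleValues, decomposition_add hΓ h, Multiset.map_add, simpleValues, simpleValues]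

theorem coeffFormula_simpleQuasiroot (hΓ : Γ ⊆ b.support) (K : ℂ) (c : SimpleOutside b Γ → ℂ)
    (i : SimpleOutside b Γ) : coeffFormula hΓ K c (simpleQuasiroot hΓ i) = c i := by
  rw [coeffFormula, simpleValues_simpleQuasiroot, numer_singleton, denom_singleton, div_one]

theorem mul_coeffFormula_add_eq_iff (hΓ : Γ ⊆ b.support) {K : ℂ} {c : SimpleOutside b Γ → ℂ}
    (hc : c ∈ admissible hΓ K) {p q r : PosQuasiroot b Γ} (h : r.1 = p.1 + q.1) (z : ℂ) :
    z * (coeffFormula hΓ K c p + coeffFormula hΓ K c q) =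
        coeffFormula hΓ K c p * coeffFormula hΓ K c q + K ^ 2 ↔ z = coeffFormula hΓ K c r := by
  have hr := hc.2 r
  simp only [coeffFormula]
  rw [simpleValues_add hΓ c h] at hr ⊢
  exact mul_div_add_div_eq_iff (hc.2 p) (hc.2 q) hr z

theorem satisfiesSchouten_coeffFormula (hE : IsRootVectors E) (hΓ : Γ ⊆ b.support) {K : ℂ}
    {c : SimpleOutside b Γ → ℂ} (hc : c ∈ admissible hΓ K) :
    SatisfiesSchouten E b Γ K (bivector E (coeffFormula hΓ K c)) :=
  (satisfiesSchouten_iff hE hΓ K _).2 fun _ _ _ h =>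
    (mul_coeffFormula_add_eq_iff hΓ hc (bar_add h) _).2 rfl

theorem eq_coeffFormula (hE : IsRootVectors E) (hΓ : Γ ⊆ b.support) {K : ℂ}
    {c : SimpleOutside b Γ → ℂ} (hc : c ∈ admissible hΓ K) {d : PosQuasiroot b Γ → ℂ}
    (hd : ∀ i, d (simpleQuasiroot hΓ i) = c i)
    (h : SatisfiesSchouten E b Γ K (bivector E d)) : d = coeffFormula hΓ K c := by
  rw [satisfiesSchouten_iff hE hΓ] at h
  have hsimple (i : SimpleOutside b Γ) :
      d (simpleQuasiroot hΓ i) = coeffFormula hΓ K c (simpleQuasiroot hΓ i) := by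
    rw [hd, coeffFormula_simpleQuasiroot]
  funext q
  induction q using PosQuasiroot.induction_on_add hΓ with
  | simple i => exact hsimple i
  | add α i γ hγ ih =>
    have hrel := h α (i.toPosOutside hΓ) γ hγ
    rw [ih, show d (i.toPosOutside hΓ).bar = _ from hsimple i] at hrel
    exact (mul_coeffFormula_add_eq_iff hΓ hc (bar_add hγ) _).1 hrel

theorem exists_const_mem_admissible (hΓ : Γ ⊆ b.support) (K : ℂ) :
    ∃ t : ℂ, (fun _ => t) ∈ admissible hΓ K := by
  obtain ⟨t, ht, hdenom⟩ := exists_denom_replicate_ne_zero K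
  refine ⟨t, fun _ => ht, fun q => ?_⟩
  rw [simpleValues, Multiset.map_const']
  exact hdenom _ (mt Multiset.card_eq_zero.1 (decomposition_ne_zero hΓ q))

theorem exists_mem_admissible_iff_eval_ne_zero (hΓ : Γ ⊆ b.support) (K : ℂ) :
    ∃ p : MvPolynomial (SimpleOutside b Γ) ℂ, p ≠ 0 ∧
      ∀ c, c ∈ admissible hΓ K ↔ MvPolynomial.eval c p ≠ 0 := by
  have := Fintype.ofFinite (PosQuasiroot b Γ)
  have := Fintype.ofFinite (SimpleOutside b Γ)
  choose _ Q hQ using fun q : PosQuasiroot b Γ =>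
    exists_eval_eq_numer_and_eval_eq_denom K (decomposition hΓ q)
  have mem_iff (c : SimpleOutside b Γ → ℂ) : c ∈ admissible hΓ K ↔
      MvPolynomial.eval c ((∏ i, MvPolynomial.X i) * ∏ q, Q q) ≠ 0 := by
    simp [admissible, simpleValues, (hQ _ c).2, Finset.prod_ne_zero_iff]
  refine ⟨_, fun h => ?_, mem_iff⟩
  obtain ⟨t, ht⟩ := exists_const_mem_admissible hΓ K
  exact (mem_iff _).1 ht (by rw [h, map_zero])

theorem bijOn_bracketFamily (hE : IsRootVectors E) (hΓ : Γ ⊆ b.support) (K : ℂ) :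
    Set.BijOn (fun c => bivector E (coeffFormula hΓ K c)) (admissible hΓ K)
      (bracketFamily E hΓ K) := by
  refine ⟨fun c hc => ?mapsTo, fun c _ c' _ h => ?injOn, ?surjOn⟩
  case mapsTo =>
    refine ⟨bivector_mem_bivectorsInM _, bivector_isLeviInvariant hE hΓ _,
      satisfiesSchouten_coeffFormula hE hΓ hc, _, rfl, ?_⟩
    simpa only [coeffFormula_simpleQuasiroot] using hc
  case injOn =>
    funext i
    simpa only [coeffFormula_simpleQuasiroot] using
      congrFun (bivector_injective hE hΓ h) (simpleQuasiroot hΓ i)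
  case surjOn =>
    rintro _ ⟨-, -, hv, d, rfl, hd⟩
    exact ⟨_, hd, congrArg _ (eq_coeffFormula hE hΓ hd (fun _ => rfl) hv).symm⟩

theorem exists_linearForm_simpleQuasiroot_eq (hΓ : Γ ⊆ b.support) (c : SimpleOutside b Γ → ℂ) :
    ∃ l : Dual ℂ (Dual ℂ H ⧸ hGamma Γ), ∀ i, l (simpleQuasiroot hΓ i).1 = c i := by
  classical
  let f : Dual ℂ H →ₗ[ℂ] ℂ := b.toWeightBasis.constr ℂ fun i : b.support =>
    if h : i.1 ∉ Γ then c ⟨i.1, i.2, h⟩ else 0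
  have f_root (i : H.root) (hi : i ∈ b.support) : f ((rootSystem H).root i) =
      if h : i ∉ Γ then c ⟨i, hi, h⟩ else 0 := by
    rw [← b.toWeightBasis_apply ⟨i, hi⟩, Basis.constr_basis]
  have hker : hGamma Γ ≤ LinearMap.ker f := by
    rw [hGamma, Submodule.span_le]
    rintro _ ⟨j, hj, rfl⟩
    rw [SetLike.mem_coe, LinearMap.mem_ker, f_root j (hΓ hj), dif_neg (not_not.2 hj)]
  exact ⟨(hGamma Γ).liftQ f hker, fun i => (f_root i.1 i.2.1).trans (dif_pos i.2.2)⟩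

theorem ne_zero_of_forall_posQuasiroot {l : Dual ℂ (Dual ℂ H ⧸ hGamma Γ)}
    (hl : ∀ q : PosQuasiroot b Γ, l q.1 ≠ 0) {q : Dual ℂ H ⧸ hGamma Γ} (hq : q ∈ quasiroots Γ) :
    l q ≠ 0 := by
  obtain ⟨hq, α, rfl⟩ := hq
  by_cases hα : b.IsPos α
  · exact hl ⟨_, hq, α, hα, rfl⟩
  · have h : l (-bar Γ α) ≠ 0 :=
      hl ⟨_, neg_ne_zero.2 hq, -α, isPos_neg_iff.2 hα, bar_neg α⟩
    rwa [map_neg, neg_ne_zero] at h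

theorem exists_linearForm_of_satisfiesSchouten_zero (hE : IsRootVectors E) (hΓ : Γ ⊆ b.support)
    {d : PosQuasiroot b Γ → ℂ} (h : SatisfiesSchouten E b Γ 0 (bivector E d))
    (hd : ∀ i, d (simpleQuasiroot hΓ i) ≠ 0) :
    ∃ l : Dual ℂ (Dual ℂ H ⧸ hGamma Γ),
      (∀ q ∈ quasiroots Γ, l q ≠ 0) ∧ ∀ q : PosQuasiroot b Γ, d q = 1 / l q.1 := by
  rw [satisfiesSchouten_iff hE hΓ] at h
  obtain ⟨l, hl⟩ :=
    exists_linearForm_simpleQuasiroot_eq hΓ fun i => (d (simpleQuasiroot hΓ i))⁻¹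
  have key (q : PosQuasiroot b Γ) : d q ≠ 0 ∧ (d q)⁻¹ = l q.1 := by
    induction q using PosQuasiroot.induction_on_add hΓ with
    | simple i => exact ⟨hd i, (hl i).symm⟩
    | add α i γ hγ ih =>
      have hrel := h α (i.toPosOutside hΓ) γ hγ
      rw [zero_pow two_ne_zero, add_zero] at hrel
      obtain ⟨hne, hinv⟩ := ne_zero_and_inv_eq_of_mul_add_eq_mul ih.1 (hd i) hrel
      have hbar : γ.bar.1 = α.bar.1 + (simpleQuasiroot hΓ i).1 := bar_add hγ
      exact ⟨hne, by rw [hinv, ih.2, hbar, map_add, hl]⟩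
  refine ⟨l, fun q => ne_zero_of_forall_posQuasiroot fun q : PosQuasiroot b Γ => ?_, fun q => ?_⟩
  · exact (key q).2 ▸ inv_ne_zero (key q).1
  · rw [← (key q).2, one_div, inv_inv]

end Solutions

end SemisimpleOrbit

end

theorem proposition3p4_general {g : Type u} [LieRing g] [LieAlgebra ℂ g] [FiniteDimensional ℂ g]
    [LieAlgebra.IsKilling ℂ g]
    (H : LieSubalgebra ℂ g) [H.IsCartanSubalgebra]
    (b : (LieAlgebra.IsKilling.rootSystem H).Base)
    (E : LieModule.Weight ℂ H g → g) (hE : IsRootVectors E)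
    (Γ : Set H.root) (hΓ : Γ ⊆ b.support) :
    (∀ K : ℂ,
      (∃ p : MvPolynomial (SimpleOutside b Γ) ℂ, p ≠ 0 ∧
        ∀ c, c ∈ admissible hΓ K ↔ MvPolynomial.eval c p ≠ 0) ∧
      (∀ c ∈ admissible hΓ K,
        (∀ i, coeffFormula hΓ K c (simpleQuasiroot hΓ i) = c i) ∧
        bivector E (coeffFormula hΓ K c) ∈ bivectorsInM E Γ ∧
        IsLeviInvariant E Γ (bivector E (coeffFormula hΓ K c)) ∧
        SatisfiesSchouten E b Γ K (bivector E (coeffFormula hΓ K c)) ∧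
        ∀ d : PosQuasiroot b Γ → ℂ, (∀ i, d (simpleQuasiroot hΓ i) = c i) →
          SatisfiesSchouten E b Γ K (bivector E d) → d = coeffFormula hΓ K c) ∧
      Set.BijOn (fun c => bivector E (coeffFormula hΓ K c))
        (admissible hΓ K) (bracketFamily E hΓ K)) ∧
    (∀ d : PosQuasiroot b Γ → ℂ, SatisfiesSchouten E b Γ 0 (bivector E d) →
      toM E Γ (schouten (bivector E d) (bivector E d)) = 0 ∧
      DefinesPoissonBracket.{w, u} E Γ (bivector E d) ∧
      ((∀ i, d (simpleQuasiroot hΓ i) ≠ 0) →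
        ∃ l : Module.Dual ℂ (Module.Dual ℂ H ⧸ hGamma Γ),
          (∀ q ∈ quasiroots Γ, l q ≠ 0) ∧ ∀ q : PosQuasiroot b Γ, d q = 1 / l q.1)) := by
  refine ⟨fun K => ⟨exists_mem_admissible_iff_eval_ne_zero hΓ K, fun c hc => ?_,
    bijOn_bracketFamily hE hΓ K⟩, fun d hd => ?_⟩
  · exact ⟨coeffFormula_simpleQuasiroot hΓ K c, bivector_mem_bivectorsInM _,
      bivector_isLeviInvariant hE hΓ _, satisfiesSchouten_coeffFormula hE hΓ hc,
      fun d hdc hd => eq_coeffFormula hE hΓ hc hdc hd⟩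
  · have hzero : toM E Γ (schouten (bivector E d) (bivector E d)) = 0 := by
      rw [show _ = _ from hd, zero_pow two_ne_zero, zero_smul]
    exact ⟨hzero, definesPoissonBracket (bivector_isLeviInvariant hE hΓ d) hzero,
      exists_linearForm_of_satisfiesSchouten_zero hE hΓ hd⟩

theorem proposition3p4 {g : Type u} [LieRing g] [LieAlgebra ℂ g] [FiniteDimensional ℂ g]
    [LieAlgebra.IsSimple ℂ g]
    (H : LieSubalgebra ℂ g) [H.IsCartanSubalgebra]
    (b : (LieAlgebra.IsKilling.rootSystem H).Base)
    (E : LieModule.Weight ℂ H g → g) (hE : IsRootVectors E)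
    (Γ : Set H.root) (hΓ : Γ ⊆ b.support) :
    -- a)
    (∀ K : ℂ,
      (∃ p : MvPolynomial (SimpleOutside b Γ) ℂ, p ≠ 0 ∧
        ∀ c, c ∈ admissible hΓ K ↔ MvPolynomial.eval c p ≠ 0) ∧
      (∀ c ∈ admissible hΓ K,
        (∀ i, coeffFormula hΓ K c (simpleQuasiroot hΓ i) = c i) ∧
        bivector E (coeffFormula hΓ K c) ∈ bivectorsInM E Γ ∧
        IsLeviInvariant E Γ (bivector E (coeffFormula hΓ K c)) ∧
        SatisfiesSchouten E b Γ K (bivector E (coeffFormula hΓ K c)) ∧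
        ∀ d : PosQuasiroot b Γ → ℂ, (∀ i, d (simpleQuasiroot hΓ i) = c i) →
          SatisfiesSchouten E b Γ K (bivector E d) → d = coeffFormula hΓ K c) ∧
      Set.BijOn (fun c => bivector E (coeffFormula hΓ K c))
        (admissible hΓ K) (bracketFamily E hΓ K)) ∧
    -- b)
    (∀ d : PosQuasiroot b Γ → ℂ, SatisfiesSchouten E b Γ 0 (bivector E d) →
      toM E Γ (schouten (bivector E d) (bivector E d)) = 0 ∧
      DefinesPoissonBracket.{w, u} E Γ (bivector E d) ∧
      ((∀ i, d (simpleQuasiroot hΓ i) ≠ 0) →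
        ∃ l : Module.Dual ℂ (Module.Dual ℂ H ⧸ hGamma Γ),
          (∀ q ∈ quasiroots Γ, l q ≠ 0) ∧ ∀ q : PosQuasiroot b Γ, d q = 1 / l q.1)) :=
  proposition3p4_general H b E hE Γ hΓ
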